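/- **Asymptotic normality of the empirical correlation coefficient.** For a probability law $V$ on $\mathbb R^2$ put $a=\int x\,dV$, $b=\int y\,dV$, $M_{ij}\{V\}=\int (x-a)^i(y-b)^j\,dV$ and $\Gamma\{V\}=M_{11}/\sqrt{M_{20}M_{02}}$. We also write $V(x,y)$ for the distribution function of $V$, with infinite arguments allowed. Let $X_1,X_2,\dots$ be independent random points of $\mathbb R^2$ with laws $V'_1,V'_2,\dots$. Let $V_n=\frac1n(V'_1+\dots+V'_n)$, and let $S_n$ be the empirical distribution of $X_1,\dots,X_n$. For a law $V$ with moments $a,b,M_{20},M_{02}$ and for $Y=(y_1,y_2)$ let $$\Gamma'\{V,Y\}=\frac{y_1y_2-b\,y_1-a\,y_2}{\sqrt{M_{20}M_{02}}}+\Gamma\{V\}\Bigl(\frac{a}{M_{20}}y_1+\frac{b}{M_{02}}y_2-\frac{y_1^2}{2M_{20}}-\frac{y_2^2}{2M_{02}}\Bigr),$$ and let $s_n\ge 0$, $H_n$ be defined by $$s_n^2=\sum_{\nu=1}^n\int\Bigl(\Gamma'\{V_n,Y\}-\int\Gamma'\{V_n,Z\}\,dV'_\nu(Z)\Bigr)^2dV'_\nu(Y),\qquad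 H_n=\frac{n}{\sqrt2\,s_n}.$$ Assume: 1. (Uniform tails.) There are $\varepsilon>0$, $N>0$ and $K$ such that, for all $\nu$ and all $t>N$, $$t^{6+\varepsilon}\,V'_\nu(-t,+\infty)\le K,\qquad t^{6+\varepsilon}\,V'_\nu(+\infty,-t)\le K,\qquad t^{6+\varepsilon}\bigl(1-V'_\nu(t,t)\bigr)\le K .$$ 2. (Variances bounded below.) There is $c>0$ with $M_{20}\{V_n\}\ge c$ and $M_{02}\{V_n\}\ge c$ for all sufficiently large $n$. 3. (Non-degeneracy of the first derivative.) There is $\delta\in(0,1)$ with $s_n/n^{1/(2+\delta)}\to\infty$. Then, for all sufficiently large $n$, $\Gamma'\{V_n,\cdot\}$ is the statistical derivative of $\Gamma$ at $V_n$: for each law $V$ with finite second moments and positive variances, $$\frac{d}{dt}\,\Gamma\{V_n+t(V-V_n)\}\Big|_{t=0^+}=\int\Gamma'\{V_n,Y\}\,d(V-V_n)(Y)$$ (with $\Gamma'\{V_n,\cdot\}$ integrable for $V$ and $V_n$). Moreover, uniformly in $u\in\mathbb R$, $$\lim_{n\to\infty}\mathbb P\bigl(H_n\,[\Gamma\{S_n\}-\Gamma\{V_n\}]\le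 u\bigr)=\frac1{\sqrt\pi}\int_{-\infty}^u e^{-t^2}\,dt .$$ -/

import Mathlib

open MeasureTheory ProbabilityTheory Filter Topology
open scoped ENNReal

noncomputable section

namespace StatFun

/-- The distribution function `V(x, y)` of a law on the plane: the probability that the first
component is at most `x` and the second at most `y`. Infinite arguments are allowed, so that
`distFun μ x ⊤` and `distFun μ ⊤ y` are the marginal distribution functions. -/
def distFun (μ : Measure (ℝ × ℝ)) (x y : EReal) : ℝ :=
  μ.real {p | (p.1 : EReal) ≤ x ∧ (p.2 : EReal) ≤ y}

/-- The mean `a` of the first component. -/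
def meanFst (μ : Measure (ℝ × ℝ)) : ℝ := ∫ p, p.1 ∂μ

/-- The mean `b` of the second component. -/
def meanSnd (μ : Measure (ℝ × ℝ)) : ℝ := ∫ p, p.2 ∂μ

/-- The central moment `M_{ij} = ∫ (x - a)^i (y - b)^j dV(x, y)`. -/
def centralMoment (i j : ℕ) (μ : Measure (ℝ × ℝ)) : ℝ :=
  ∫ p, (p.1 - meanFst μ) ^ i * (p.2 - meanSnd μ) ^ j ∂μ

/-- The correlation coefficient `Γ = M_11 / √(M_20 M_02)`, as a function of the distribution. -/
def corr (μ : Measure (ℝ × ℝ)) : ℝ :=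
  centralMoment 1 1 μ / Real.sqrt (centralMoment 2 0 μ * centralMoment 0 2 μ)

/-- The convex set of distributions on which `Γ` is defined: the probability laws on the plane with
finite second moments and with nonzero variances. -/
def corrDomain : Set (Measure (ℝ × ℝ)) :=
  {μ | IsProbabilityMeasure μ ∧ Integrable (fun p : ℝ × ℝ => p.1 ^ 2) μ ∧
    Integrable (fun p : ℝ × ℝ => p.2 ^ 2) μ ∧ 0 < centralMoment 2 0 μ ∧ 0 < centralMoment 0 2 μ}

/-- The point `V₁ + t (V - V₁)`, `0 ≤ t ≤ 1`, of the segment from `V₁` to `V`. -/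
def segmentPoint (V₁ V : Measure (ℝ × ℝ)) (t : ℝ) : Measure (ℝ × ℝ) :=
  ENNReal.ofReal (1 - t) • V₁ + ENNReal.ofReal t • V

/-- `g` is the derivative `f'{V₁, ·}` at `V₁` of the statistical function `f` defined on `J`:
for every `V` in `J`, the function `t ↦ f{V₁ + t (V - V₁)}` has at `t = 0` the derivative
`∫ g d(V - V₁)`. -/
def HasStatDeriv (J : Set (Measure (ℝ × ℝ))) (f : Measure (ℝ × ℝ) → ℝ)
    (V₁ : Measure (ℝ × ℝ)) (g : ℝ × ℝ → ℝ) : Prop :=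
  V₁ ∈ J ∧ Integrable g V₁ ∧ ∀ V ∈ J, Integrable g V ∧
    HasDerivWithinAt (fun t : ℝ => f (segmentPoint V₁ V t))
      ((∫ y, g y ∂V) - ∫ y, g y ∂V₁) (Set.Icc 0 1) 0

/-- The derivative `Γ'{V, Y}` of the correlation coefficient, `Y = (y₁, y₂)`:
`(y₁ y₂ - b y₁ - a y₂) / √(M_20 M_02)
  + Γ (a y₁ / M_20 + b y₂ / M_02 - y₁² / (2 M_20) - y₂² / (2 M_02))`. -/
def corrDeriv (μ : Measure (ℝ × ℝ)) (y : ℝ × ℝ) : ℝ :=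
  (y.1 * y.2 - meanSnd μ * y.1 - meanFst μ * y.2) /
      Real.sqrt (centralMoment 2 0 μ * centralMoment 0 2 μ)
    + corr μ * (meanFst μ / centralMoment 2 0 μ * y.1 + meanSnd μ / centralMoment 0 2 μ * y.2
      - y.1 ^ 2 / (2 * centralMoment 2 0 μ) - y.2 ^ 2 / (2 * centralMoment 0 2 μ))

/-- The mean distribution `V_n = (V'_1 + ⋯ + V'_n) / n` (indices start at `0` here). -/
def meanLaw (V' : ℕ → Measure (ℝ × ℝ)) (n : ℕ) : Measure (ℝ × ℝ) :=
  (n : ℝ≥0∞)⁻¹ • ∑ ν ∈ Finset.range n, V' ν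

/-- The empirical distribution `S_n` of the first `n` points of a sequence. -/
def empLaw (x : ℕ → ℝ × ℝ) (n : ℕ) : Measure (ℝ × ℝ) :=
  (n : ℝ≥0∞)⁻¹ • ∑ ν ∈ Finset.range n, Measure.dirac (x ν)

/-- `s_n = √(r_1² + ⋯ + r_n²)`, where `r_ν²` is the variance of `Γ'{V_n, ·}` under `V'_ν`. -/
def sdSum (V' : ℕ → Measure (ℝ × ℝ)) (n : ℕ) : ℝ :=
  Real.sqrt (∑ ν ∈ Finset.range n,
    ∫ y, (corrDeriv (meanLaw V' n) y - ∫ z, corrDeriv (meanLaw V' n) z ∂(V' ν)) ^ 2 ∂(V' ν))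

/-- The constant `H_n > 0` with `1 / (2 H_n²) = s_n² / n²`. -/
def normConst (V' : ℕ → Measure (ℝ × ℝ)) (n : ℕ) : ℝ :=
  n / (Real.sqrt 2 * sdSum V' n)

/-- The Gaussian limit `φ(u) = (1/√π) ∫_{-∞}^u exp(-t²) dt`. -/
def gaussLimit (u : ℝ) : ℝ :=
  (1 / Real.sqrt Real.pi) * ∫ t in Set.Iic u, Real.exp (-t ^ 2)

/-- The tail condition of order `q`, uniform in `ν`: the probabilities that some component
is at most `-t`, or exceeds `t`, are at most a constant times `t ^ (-q)` for `t > N`. -/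
def UniformTail (V' : ℕ → Measure (ℝ × ℝ)) (q N K : ℝ) : Prop :=
  ∀ ν : ℕ, ∀ t : ℝ, N < t →
    t ^ q * distFun (V' ν) ((-t : ℝ) : EReal) ⊤ ≤ K ∧
    t ^ q * distFun (V' ν) ⊤ ((-t : ℝ) : EReal) ≤ K ∧
    t ^ q * (1 - distFun (V' ν) (t : EReal) (t : EReal)) ≤ K

end StatFun

end

noncomputable section

namespace StatFun

/-! ### Taylor bounds and characteristic functions -/

/-! The correlation coefficient depends on a law only through its five first and second raw moments,
and it is a smooth function of them where the variances stay away from zero. Hence its linearization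
error is at most a constant times the squared moment distance, with one constant for all laws with
bounded moments and variances at least `c` (`exists_corr_expansion`). Along a segment the moments
are affine in `t`, so the error is `O(t²)` and the derivative formula follows (`hasStatDeriv_corr`).

The same expansion linearizes at `V_n`, with the empirical law as increment. The linear part, times
`H_n`, is a sum of independent centred variables of total variance exactly `1/2`. The derivative
grows quadratically, so its third moments are controlled by sixth moments, which the tails bound
uniformly. The Lyapunov sum is then `O(n / s_n³)`, and it vanishes because `s_n / n^(1/3) → ∞`. This
gives the limit law (`tendstoInDistribution_of_lyapunov`, `tendstoInDistribution_sum_linearTerm`).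

The squared moment distance between empirical and mean law has expectation `O(1/n)`. Since `H_n ≤ n
/ s_n`, the normalized error is `O(1/s_n)` in probability (`tendstoInMeasure_normConst_mul_sub`).
Slutsky's theorem transfers the limit law, and Pólya's theorem makes the convergence uniform. -/

lemma norm_cexp_sub_taylor_two_le (x : ℝ) :
    ‖Complex.exp (x * Complex.I) - (1 + x * Complex.I - x ^ 2 / 2)‖ ≤ 4 * |x| ^ 3 := by
  have hn : ‖(x : ℂ) * Complex.I‖ = |x| := by simp
  -- Near zero the remainder of the exponential series suffices; for `|x| ≥ 1` each of `1`, `|x|`,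
  -- `x²` is at most `|x|³`, and the triangle inequality is enough.
  rcases le_total |x| 1 with hx | hx
  · have h := Complex.exp_bound (x := x * Complex.I) (by rw [hn]; exact hx) (n := 3) (by norm_num)
    rw [hn] at h
    have e : ∑ m ∈ Finset.range 3, ((x : ℂ) * Complex.I) ^ m / (m.factorial : ℂ) =
        1 + x * Complex.I - x ^ 2 / 2 := by
      simp [Finset.sum_range_succ, mul_pow, Nat.factorial]
      ring
    rw [e] at h
    refine h.trans ?_
    have h3 : 0 ≤ |x| ^ 3 := by positivity
    norm_num [Nat.factorial]
    linarith
  · have h1 : ‖(1 : ℂ) + x * Complex.I - x ^ 2 / 2‖ ≤ 1 + |x| + |x| ^ 2 / 2 := by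
      refine (norm_sub_le _ _).trans ?_
      refine add_le_add ((norm_add_le _ _).trans (by simp)) (by simp)
    have h2 : ‖Complex.exp (x * Complex.I)‖ = 1 := Complex.norm_exp_ofReal_mul_I x
    refine (norm_sub_le _ _).trans ?_
    rw [h2]
    have h4 : 1 ≤ |x| ^ 2 := one_le_pow₀ hx
    have h5 : |x| ^ 2 ≤ |x| ^ 3 := pow_le_pow_right₀ hx (by norm_num)
    have h6 : |x| ≤ |x| ^ 2 := by nlinarith
    linarith

/-- The true order near zero is `s⁴`; the cubic bound is valid for all `s ≥ 0` and matches a third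
absolute moment. -/
lemma abs_exp_neg_sq_sub_le {s : ℝ} (hs : 0 ≤ s) :
    |Real.exp (-s ^ 2) - (1 - s ^ 2)| ≤ s ^ 3 := by
  have h0 : -s ^ 2 + 1 ≤ Real.exp (-s ^ 2) := Real.add_one_le_exp _
  rw [abs_of_nonneg (by linarith)]
  rcases le_total s 1 with h | h
  · have h1 : |-s ^ 2| ≤ 1 := by
      rw [abs_neg, abs_of_nonneg (by positivity)]
      exact pow_le_one₀ hs h
    have h2 := Real.norm_exp_sub_one_sub_id_le (x := -s ^ 2) (by simpa using h1)
    rw [Real.norm_eq_abs, Real.norm_eq_abs, sq_abs] at h2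
    have h3 := (abs_le.1 h2).2
    have h4 : (-s ^ 2) ^ 2 ≤ s ^ 3 := by
      have : 0 ≤ s ^ 3 := by positivity
      nlinarith
    linarith
  · have h1 : Real.exp (-s ^ 2) ≤ 1 := Real.exp_le_one_iff.2 (by nlinarith [sq_nonneg s])
    have h2 : s ^ 2 ≤ s ^ 3 := pow_le_pow_right₀ h (by norm_num)
    linarith

lemma integrable_abs_pow_of_le {α : Type*} [MeasurableSpace α] {μ : Measure α} [IsFiniteMeasure μ]
    {f : α → ℝ} (hf : AEStronglyMeasurable f μ) {p q : ℕ} (hpq : p ≤ q)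
    (h : Integrable (fun x => |f x| ^ q) μ) : Integrable (fun x => |f x| ^ p) μ := by
  refine (h.add (integrable_const 1)).mono' (hf.norm.pow p) (ae_of_all _ fun x => ?_)
  rw [Real.norm_eq_abs, abs_of_nonneg (by positivity)]
  simp only [Pi.add_apply]
  rcases le_total |f x| 1 with h | h
  · have : |f x| ^ p ≤ 1 := pow_le_one₀ (abs_nonneg _) h
    have : 0 ≤ |f x| ^ q := by positivity
    linarith
  · have := pow_le_pow_right₀ h hpq
    linarith

lemma sqrt_integral_sq_pow_three_le {μ : Measure ℝ} [IsProbabilityMeasure μ]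
    (h3 : Integrable (fun x => |x| ^ 3) μ) :
    √(∫ x, x ^ 2 ∂μ) ^ 3 ≤ ∫ x, |x| ^ 3 ∂μ := by
  have h2 : Integrable (fun x : ℝ => x ^ 2) μ := by
    simpa using integrable_abs_pow_of_le (f := fun x : ℝ => x)
      measurable_id.aestronglyMeasurable (by norm_num : 2 ≤ 3) h3
  set σ := √(∫ x, x ^ 2 ∂μ) with hσ
  have hσ0 : 0 ≤ σ := Real.sqrt_nonneg _
  have hσ2 : σ ^ 2 = ∫ x, x ^ 2 ∂μ := Real.sq_sqrt (integral_nonneg fun x => sq_nonneg x)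
  -- The integrated pointwise inequality is `(|x| - σ)² (2|x| + σ) ≥ 0`; since `∫ x² = σ²`, it
  -- yields `3σ³ ≤ 2 ∫ |x|³ + σ³`.
  have hle : ∫ x, 3 * σ * x ^ 2 ∂μ ≤ ∫ x, (2 * |x| ^ 3 + σ ^ 3) ∂μ := by
    refine integral_mono (h2.const_mul _) ((h3.const_mul 2).add (integrable_const _)) fun x => ?_
    have hx := abs_nonneg x
    simp only
    rw [← sq_abs x]
    nlinarith [mul_nonneg (sq_nonneg (|x| - σ)) (by linarith : 0 ≤ 2 * |x| + σ)]
  rw [integral_const_mul, ← hσ2, integral_add (h3.const_mul 2) (integrable_const _),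
    integral_const_mul] at hle
  simp at hle
  nlinarith

/-- Both functions share the second-order Taylor polynomial `1 - t² m / 2`: the constant `5` is `4`
for the characteristic function plus `1` for the Gaussian. -/
lemma norm_charFun_sub_exp_le {μ : Measure ℝ} [IsProbabilityMeasure μ]
    (h3 : Integrable (fun x => |x| ^ 3) μ) (h0 : ∫ x, x ∂μ = 0) (t : ℝ) :
    ‖charFun μ t - Real.exp (-(t ^ 2 * (∫ x, x ^ 2 ∂μ) / 2))‖ ≤ 5 * |t| ^ 3 * ∫ x, |x| ^ 3 ∂μ := by
  have h2 : Integrable (fun x : ℝ => x ^ 2) μ := by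
    simpa using integrable_abs_pow_of_le (f := fun x : ℝ => x)
      measurable_id.aestronglyMeasurable (by norm_num : 2 ≤ 3) h3
  have h1 : Integrable (fun x : ℝ => x) μ := by
    have := integrable_abs_pow_of_le (f := fun x : ℝ => x)
      measurable_id.aestronglyMeasurable (by norm_num : 1 ≤ 3) h3
    exact (integrable_norm_iff measurable_id.aestronglyMeasurable).1 (by simpa using this)
  set m := ∫ x, x ^ 2 ∂μ with hm
  have hm0 : 0 ≤ m := integral_nonneg fun x => sq_nonneg x
  have hT : ∫ x : ℝ, (1 + (t * x : ℝ) * Complex.I - ((t * x : ℝ) : ℂ) ^ 2 / 2) ∂μ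
      = ((1 - t ^ 2 * m / 2 : ℝ) : ℂ) := by
    have e : ∀ x : ℝ, (1 + (t * x : ℝ) * Complex.I - ((t * x : ℝ) : ℂ) ^ 2 / 2)
        = ((1 - t ^ 2 / 2 * x ^ 2 : ℝ) : ℂ) + ((x : ℝ) : ℂ) * (t * Complex.I) := by
      intro x; push_cast; ring
    simp_rw [e]
    rw [integral_add (by exact ((integrable_const _).sub (h2.const_mul _)).ofReal)
      (h1.ofReal.mul_const _), integral_complex_ofReal, integral_mul_const,
      integral_complex_ofReal, h0,
      integral_sub (integrable_const _) (h2.const_mul _), integral_const_mul, ← hm]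
    simp
    ring
  have hTi : Integrable (fun x : ℝ => (1 + (t * x : ℝ) * Complex.I - ((t * x : ℝ) : ℂ) ^ 2 / 2)) μ := by
    refine ((integrable_const _).add ((h1.const_mul t).ofReal.mul_const _)).sub ?_
    have := ((h2.const_mul (t ^ 2)).ofReal (𝕜 := ℂ)).div_const 2
    refine this.congr (ae_of_all _ fun x => ?_)
    simp [mul_pow]
  have hE : Integrable (fun x : ℝ => Complex.exp ((t * x : ℝ) * Complex.I)) μ := by
    refine Integrable.of_bound (C := 1) (by fun_prop) (ae_of_all _ fun x => ?_)
    rw [Complex.norm_exp_ofReal_mul_I]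
  have hA : ‖charFun μ t - ((1 - t ^ 2 * m / 2 : ℝ) : ℂ)‖ ≤ 4 * |t| ^ 3 * ∫ x, |x| ^ 3 ∂μ := by
    rw [charFun_apply_real, ← hT]
    have : ∫ x : ℝ, Complex.exp (t * x * Complex.I) ∂μ =
        ∫ x : ℝ, Complex.exp ((t * x : ℝ) * Complex.I) ∂μ := by simp
    rw [this, ← integral_sub hE hTi, ← integral_const_mul]
    refine norm_integral_le_of_norm_le (h3.const_mul _) (ae_of_all _ fun x => ?_)
    refine (norm_cexp_sub_taylor_two_le (t * x)).trans (le_of_eq ?_)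
    rw [abs_mul, mul_pow]; ring
  have hB : ‖((1 - t ^ 2 * m / 2 : ℝ) : ℂ) - Real.exp (-(t ^ 2 * m / 2))‖
      ≤ |t| ^ 3 * ∫ x, |x| ^ 3 ∂μ := by
    rw [← Complex.ofReal_sub, Complex.norm_real, norm_sub_rev, Real.norm_eq_abs]
    have hs : (|t| * √(m / 2)) ^ 2 = t ^ 2 * m / 2 := by
      rw [mul_pow, sq_abs, Real.sq_sqrt (by positivity)]; ring
    have h := abs_exp_neg_sq_sub_le (s := |t| * √(m / 2)) (by positivity)
    rw [hs] at h
    refine h.trans ?_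
    rw [mul_pow]
    refine mul_le_mul_of_nonneg_left ?_ (by positivity)
    refine le_trans ?_ (sqrt_integral_sq_pow_three_le h3)
    exact pow_le_pow_left₀ (Real.sqrt_nonneg _) (Real.sqrt_le_sqrt (by linarith)) 3
  calc _ ≤ _ := norm_sub_le_norm_sub_add_norm_sub _ _ _
    _ ≤ _ := add_le_add hA hB
    _ = _ := by ring

/-- Factors are exchanged one at a time, the others contributing norm at most one. -/
lemma norm_prod_sub_prod_le_sum {ι R : Type*} [NormedCommRing R] [NormOneClass R] (s : Finset ι) {f g : ι → R}
    (hf : ∀ i ∈ s, ‖f i‖ ≤ 1) (hg : ∀ i ∈ s, ‖g i‖ ≤ 1) :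
    ‖∏ i ∈ s, f i - ∏ i ∈ s, g i‖ ≤ ∑ i ∈ s, ‖f i - g i‖ := by
  classical
  induction s using Finset.induction_on with
  | empty => simp
  | insert a s ha ih =>
    have hf' : ∀ i ∈ s, ‖f i‖ ≤ 1 := fun i hi => hf i (Finset.mem_insert_of_mem hi)
    have hg' : ∀ i ∈ s, ‖g i‖ ≤ 1 := fun i hi => hg i (Finset.mem_insert_of_mem hi)
    rw [Finset.prod_insert ha, Finset.prod_insert ha, Finset.sum_insert ha]
    have e : f a * ∏ i ∈ s, f i - g a * ∏ i ∈ s, g i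
        = (f a - g a) * ∏ i ∈ s, f i + g a * (∏ i ∈ s, f i - ∏ i ∈ s, g i) := by ring
    have hp : ‖∏ i ∈ s, f i‖ ≤ 1 :=
      (Finset.norm_prod_le _ _).trans (Finset.prod_le_one (fun _ _ => norm_nonneg _) hf')
    rw [e]
    refine (norm_add_le _ _).trans (add_le_add ?_ ?_)
    · exact (norm_mul_le _ _).trans (mul_le_of_le_one_right (norm_nonneg _) hp)
    · exact (norm_mul_le _ _).trans
        ((mul_le_of_le_one_left (norm_nonneg _) (hg a (Finset.mem_insert_self _ _))).trans
          (ih hf' hg'))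

/-! ### Lyapunov's central limit theorem -/

variable {Ω : Type*} [MeasurableSpace Ω] {P : Measure Ω} [IsProbabilityMeasure P]

/-- **Lyapunov's central limit theorem** for triangular arrays, with third absolute moments. -/
theorem tendstoInDistribution_of_lyapunov {Y : ℕ → ℕ → Ω → ℝ} {v : NNReal}
    (hindep : ∀ n, iIndepFun (Y n) P) (hmeas : ∀ n k, AEMeasurable (Y n k) P)
    (h3 : ∀ n k, Integrable (fun ω => |Y n k ω| ^ 3) P) (h0 : ∀ n k, ∫ ω, Y n k ω ∂P = 0)
    (hvar : ∀ᶠ n in atTop, ∑ k ∈ Finset.range n, ∫ ω, Y n k ω ^ 2 ∂P = v)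
    (hlim : Tendsto (fun n => ∑ k ∈ Finset.range n, ∫ ω, |Y n k ω| ^ 3 ∂P) atTop (𝓝 0)) :
    TendstoInDistribution (fun n ω => ∑ k ∈ Finset.range n, Y n k ω) atTop (id : ℝ → ℝ)
      (fun _ => P) (gaussianReal 0 v) where
  forall_aemeasurable n := Finset.aemeasurable_fun_sum _ fun _ _ => hmeas _ _
  tendsto := by
    refine ProbabilityMeasure.tendsto_iff_tendsto_charFun.2 fun t => ?_
    simp only [ProbabilityMeasure.coe_mk, Measure.map_id]
    have hg : charFun (gaussianReal 0 v) t = Real.exp (-(t ^ 2 * v / 2)) := by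
      rw [charFun_gaussianReal]
      push_cast
      congr 1
      simp
      ring
    rw [hg, tendsto_iff_norm_sub_tendsto_zero]
    have hb : Tendsto (fun n => 5 * |t| ^ 3 * ∑ k ∈ Finset.range n, ∫ ω, |Y n k ω| ^ 3 ∂P) atTop
        (𝓝 0) := by simpa using hlim.const_mul (5 * |t| ^ 3)
    refine squeeze_zero' (Eventually.of_forall fun _ => norm_nonneg _) ?_ hb
    filter_upwards [hvar] with n hn
    rw [((hindep n).restrict _).charFun_map_fun_finsetSum_eq_prod (fun k _ => hmeas n k),
      Finset.prod_apply]
    have hs : ∑ k ∈ Finset.range n, ∫ x, x ^ 2 ∂(P.map (Y n k)) = v := by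
      rw [← hn]
      exact Finset.sum_congr rfl fun k _ => integral_map (hmeas n k) (by fun_prop)
    -- The Gaussian limit is split with the variances of the row, so that each factor is compared
    -- with a Gaussian of its own variance.
    have he : ((Real.exp (-(t ^ 2 * v / 2)) : ℝ) : ℂ) = ∏ k ∈ Finset.range n,
        ((Real.exp (-(t ^ 2 * (∫ x, x ^ 2 ∂(P.map (Y n k))) / 2)) : ℝ) : ℂ) := by
      rw [← Complex.ofReal_prod, ← Real.exp_sum, Finset.sum_neg_distrib, ← Finset.sum_div,
        ← Finset.mul_sum, hs]
    rw [he]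
    have hprob : ∀ k, IsProbabilityMeasure (P.map (Y n k)) :=
      fun k => Measure.isProbabilityMeasure_map (hmeas n k)
    refine (norm_prod_sub_prod_le_sum _ (fun k _ => norm_charFun_le_one _) fun k _ => ?_).trans ?_
    · rw [Complex.norm_real, Real.norm_eq_abs, Real.abs_exp, Real.exp_le_one_iff, neg_nonpos]
      have : 0 ≤ ∫ x, x ^ 2 ∂(P.map (Y n k)) := integral_nonneg fun x => sq_nonneg x
      positivity
    · rw [Finset.mul_sum]
      refine Finset.sum_le_sum fun k _ => ?_
      have e3 : ∫ ω, |Y n k ω| ^ 3 ∂P = ∫ x, |x| ^ 3 ∂(P.map (Y n k)) := by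
        rw [integral_map (hmeas n k) (by fun_prop)]
      rw [e3]
      refine norm_charFun_sub_exp_le ?_ ?_ t
      · exact (integrable_map_measure (by fun_prop) (hmeas n k)).2 (h3 n k)
      · rw [integral_map (hmeas n k) (by fun_prop)]; exact h0 n k

/-! ### Pólya's theorem -/

/-- A single level `r` in `(0, 1)` is attained as `F x`; convergence at the one point `x` then
serves every `u ≥ x` by monotonicity. -/
lemma eventually_forall_lt_of_monotone {F : ℝ → ℝ} {G : ℕ → ℝ → ℝ} (hF : Continuous F)
    (hFm : Monotone F) (hF1 : Tendsto F atTop (𝓝 1))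
    (hF0 : Tendsto F atBot (𝓝 0)) (hGm : ∀ n, Monotone (G n)) (hG0 : ∀ n x, 0 ≤ G n x)
    (hlim : ∀ x, Tendsto (fun n => G n x) atTop (𝓝 (F x))) (r : ℝ) {e : ℝ} (he : 0 < e) :
    ∀ᶠ n in atTop, ∀ u, r < F u → r - e < G n u := by
  rcases le_or_gt r 0 with hr | hr
  · exact Eventually.of_forall fun n u _ => by linarith [hG0 n u]
  rcases le_or_gt 1 r with hr1 | hr1
  · exact Eventually.of_forall fun n u h => by linarith [hFm.ge_of_tendsto hF1 u]
  obtain ⟨x, hx⟩ := mem_range_of_exists_le_of_exists_ge hF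
    ((hF0.eventually (eventually_le_nhds hr)).exists)
    ((hF1.eventually (eventually_ge_nhds hr1)).exists)
  filter_upwards [(hlim x).eventually (eventually_gt_nhds (by linarith : F x - e < F x))] with n hn u hu
  have : x ≤ u := (hFm.reflect_lt (hx ▸ hu)).le
  linarith [hGm n this]

/-- **Pólya's theorem**: pointwise convergence of distribution functions to a continuous
distribution function is uniform. -/
theorem tendstoUniformly_of_monotone_of_continuous {F : ℝ → ℝ} {G : ℕ → ℝ → ℝ} (hF : Continuous F)
    (hFm : Monotone F) (hF1 : Tendsto F atTop (𝓝 1))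
    (hF0 : Tendsto F atBot (𝓝 0)) (hGm : ∀ n, Monotone (G n)) (hG0 : ∀ n x, 0 ≤ G n x)
    (hG1 : ∀ n x, G n x ≤ 1)
    (hlim : ∀ x, Tendsto (fun n => G n x) atTop (𝓝 (F x))) :
    TendstoUniformly G F atTop := by
  rw [Metric.tendstoUniformly_iff]
  intro ε hε
  have key : ∀ {F : ℝ → ℝ} {G : ℕ → ℝ → ℝ}, Continuous F → Monotone F → Tendsto F atTop (𝓝 1) →
      Tendsto F atBot (𝓝 0) → (∀ n, Monotone (G n)) → (∀ n x, 0 ≤ G n x) →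
      (∀ x, Tendsto (fun n => G n x) atTop (𝓝 (F x))) →
      ∀ᶠ n in atTop, ∀ u, F u - ε < G n u := by
    intro F G hF hFm hF1 hF0 hGm hG0 hlim
    -- For `j = ⌊m F(u)⌋` the level `(j - 1)/m` lies strictly below `F u` and less than `2/m` away;
    -- the slack `1/m` in the one-level lemma brings the loss to `3/m < ε`.
    obtain ⟨m, hm⟩ := exists_nat_gt (3 / ε)
    have hm0 : (0 : ℝ) < m := lt_trans (by positivity) hm
    have hd : 3 / (m : ℝ) < ε := by rwa [div_lt_comm₀ hm0 hε]
    have hall : ∀ᶠ n in atTop, ∀ j ∈ Finset.range (m + 1), ∀ u, ((j : ℝ) - 1) / m < F u →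
        ((j : ℝ) - 1) / m - 1 / m < G n u := by
      rw [Filter.eventually_all_finset]
      exact fun j _ => eventually_forall_lt_of_monotone hF hFm hF1 hF0 hGm hG0 hlim _ (by positivity)
    filter_upwards [hall] with n hn u
    have hu0 : 0 ≤ F u := hFm.le_of_tendsto hF0 u
    have hu1 : F u ≤ 1 := hFm.ge_of_tendsto hF1 u
    have hj := Nat.floor_le (mul_nonneg hm0.le hu0)
    have hj' := Nat.lt_floor_add_one (m * F u)
    set j := ⌊m * F u⌋₊
    have hjm : j < m + 1 := by
      have : (j : ℝ) ≤ m := hj.trans (mul_le_of_le_one_right hm0.le hu1)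
      exact Nat.lt_succ_of_le (by exact_mod_cast this)
    have h1 := hn j (Finset.mem_range.2 hjm) u (by rw [div_lt_iff₀ hm0]; linarith)
    have h2 : F u < ((j : ℝ) + 1) / m := by rw [lt_div_iff₀ hm0]; linarith
    have h3 : ((j : ℝ) + 1) / m = ((j : ℝ) - 1) / m - 1 / m + 3 / m := by ring
    linarith
  have hlow := key hF hFm hF1 hF0 hGm hG0 hlim
  -- The upper bound is the lower bound for the reflected functions.
  have hup := key (F := fun x => 1 - F (-x)) (G := fun n x => 1 - G n (-x)) (by fun_prop)
    (fun x y h => by have := hFm (neg_le_neg h); simp only; linarith)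
    (by simpa using (hF0.comp tendsto_neg_atTop_atBot).const_sub 1)
    (by simpa using (hF1.comp tendsto_neg_atBot_atTop).const_sub 1)
    (fun n x y h => by have := hGm n (neg_le_neg h); simp only; linarith)
    (fun n x => by linarith [hG1 n (-x)]) (fun x => (hlim (-x)).const_sub 1)
  filter_upwards [hlow, hup] with n h1 h2 u
  have h2' := h2 (-u)
  simp only [neg_neg] at h2'
  rw [Real.dist_eq, abs_lt]
  constructor <;> linarith [h1 u]

/-! ### The Gaussian limit -/

lemma gaussLimit_eq_measureReal (u : ℝ) :
    gaussLimit u = (gaussianReal 0 (1 / 2)).real (Set.Iic u) := by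
  rw [measureReal_def, gaussianReal_apply_eq_integral _ (by norm_num), gaussLimit,
    ENNReal.toReal_ofReal (integral_nonneg fun x => gaussianPDFReal_nonneg _ _ _),
    ← integral_const_mul]
  congr 1
  ext t
  simp [gaussianPDFReal]
  field_simp

lemma gaussLimit_eq_cdf : gaussLimit = cdf (gaussianReal 0 (1 / 2)) := by
  ext u
  rw [gaussLimit_eq_measureReal, cdf_eq_real]

lemma continuous_gaussLimit : Continuous gaussLimit := by
  have hi : Integrable (fun t : ℝ => Real.exp (-t ^ 2)) := by
    simpa using integrable_exp_neg_mul_sq (b := 1) one_pos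
  refine continuous_const.mul ?_
  have e : (fun u => ∫ t in Set.Iic u, Real.exp (-t ^ 2)) =
      fun u => (∫ t in Set.Iic 0, Real.exp (-t ^ 2)) + ∫ t in (0 : ℝ)..u, Real.exp (-t ^ 2) := by
    ext u
    rw [← intervalIntegral.integral_Iic_sub_Iic hi.integrableOn hi.integrableOn]
    ring
  rw [e]
  exact continuous_const.add (intervalIntegral.continuous_primitive
    (fun a b => hi.intervalIntegrable) 0)

/-- Convergence in distribution to the centred Gaussian law of variance `1 / 2` is uniform
convergence of the distribution functions to `gaussLimit`. -/
theorem tendstoUniformly_gaussLimit_of_tendstoInDistribution {Z : ℕ → Ω → ℝ}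
    (h : TendstoInDistribution Z atTop (id : ℝ → ℝ) (fun _ => P) (gaussianReal 0 (1 / 2))) :
    TendstoUniformly (fun n u => P.real {ω | Z n ω ≤ u}) gaussLimit atTop := by
  have hno : NullSingletonClass (gaussianReal 0 (1 / 2)) :=
    nullSingletonClass_gaussianReal (by norm_num)
  refine tendstoUniformly_of_monotone_of_continuous continuous_gaussLimit ?_ ?_ ?_ ?_ ?_ ?_ ?_
  · rw [gaussLimit_eq_cdf]; exact monotone_cdf _
  · rw [gaussLimit_eq_cdf]; exact tendsto_cdf_atTop _
  · rw [gaussLimit_eq_cdf]; exact tendsto_cdf_atBot _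
  · exact fun n x y hxy => measureReal_mono fun ω (hω : _ ≤ _) => hω.trans hxy
  · exact fun n x => measureReal_nonneg
  · exact fun n x => measureReal_le_one
  · intro u
    have := ProbabilityMeasure.tendsto_measure_of_null_frontier_of_tendsto' h.tendsto
      (E := Set.Iic u) (by
        rw [ProbabilityMeasure.coe_mk, Measure.map_id, frontier_Iic]; exact measure_singleton u)
    simp only [ProbabilityMeasure.coe_mk, Measure.map_id] at this
    have h2 := (ENNReal.tendsto_toReal (measure_ne_top _ _)).comp this
    rw [gaussLimit_eq_measureReal]
    refine h2.congr fun n => ?_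
    simp only [Function.comp_apply]
    rw [Measure.map_apply_of_aemeasurable (h.forall_aemeasurable n) measurableSet_Iic]
    rfl

end StatFun

namespace StatFun

/-! ### Second-order expansion of the correlation coefficient -/

/-- With `s = √w` the error is exactly `(s - 1)² (s + 2) / (2s)`, while `(w - 1)² = (s - 1)² (s +
1)²`; the bound `s ≥ 1/2` controls the quotient. -/
lemma abs_inv_sqrt_sub_taylor_le {w : ℝ} (hw : 1 / 4 ≤ w) :
    |1 / √w - (1 - (w - 1) / 2)| ≤ 5 / 2 * (w - 1) ^ 2 := by
  have hs : 1 / 2 ≤ √w := Real.le_sqrt_of_sq_le (by norm_num; linarith)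
  have hs2 : √w ^ 2 = w := Real.sq_sqrt (by linarith)
  set s := √w
  have hs0 : 0 < s := by linarith
  rw [← hs2]
  have e : 1 / s - (1 - (s ^ 2 - 1) / 2) = (s - 1) ^ 2 * (s + 2) / (2 * s) := by
    field_simp; ring
  rw [e, abs_of_nonneg (by positivity), div_le_iff₀ (by positivity)]
  have h1 : (s ^ 2 - 1) ^ 2 = (s - 1) ^ 2 * (s + 1) ^ 2 := by ring
  rw [h1]
  have : (s + 2) ≤ 5 / 2 * (s + 1) ^ 2 * (2 * s) := by nlinarith [mul_pos hs0 hs0]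
  nlinarith [mul_le_mul_of_nonneg_left this (sq_nonneg (s - 1))]

/-- Here `α`, `β` are the relative increments of the variances and `γ` is the covariance increment
divided by `√(pq)`. The error splits into a multiple of `G` and a term containing `γ`, both
quadratic. -/
lemma abs_ratio_sub_taylor_le {G α β γ : ℝ} (hα : |α| ≤ 1 / 2) (hβ : |β| ≤ 1 / 2)
    (hγ : |γ| ≤ 1 / 2) :
    |(G + γ) / √((1 + α) * (1 + β)) - (G + γ - G * (α + β) / 2)|
      ≤ 20 * (1 + |G|) * (α ^ 2 + β ^ 2 + γ ^ 2) := by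
  rw [abs_le] at hα hβ
  have hw : 1 / 4 ≤ (1 + α) * (1 + β) := by nlinarith
  have hρ := abs_inv_sqrt_sub_taylor_le hw
  set ρ := 1 / √((1 + α) * (1 + β)) - (1 - ((1 + α) * (1 + β) - 1) / 2) with hρd
  have hw1 : (1 + α) * (1 + β) - 1 = α + β + α * β := by ring
  rw [hw1] at hρ hρd
  set z := α + β + α * β with hz
  have hz2 : z ^ 2 ≤ 4 * (α ^ 2 + β ^ 2) := by
    have h1 : (α * β) ^ 2 ≤ α ^ 2 / 4 := by
      have : β ^ 2 ≤ 1 / 4 := by nlinarith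
      rw [mul_pow]; nlinarith [sq_nonneg α]
    nlinarith [sq_nonneg (α - β), sq_nonneg (α - α * β), sq_nonneg (β - α * β), sq_nonneg β]
  have e : (G + γ) / √((1 + α) * (1 + β)) - (G + γ - G * (α + β) / 2)
      = G * (ρ - α * β / 2) + (γ * ρ - γ * z / 2) := by
    rw [div_eq_mul_one_div]
    have : 1 / √((1 + α) * (1 + β)) = ρ + (1 - z / 2) := by rw [hρd]; ring
    rw [this, hz]; ring
  set T := α ^ 2 + β ^ 2 + γ ^ 2 with hT
  have hγ0 := sq_nonneg γ
  have hρT : |ρ| ≤ 10 * T := hρ.trans (by rw [hT]; linarith)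
  have h1 : |ρ - α * β / 2| ≤ 11 * T := by
    refine (abs_sub _ _).trans ?_
    have : |α * β / 2| ≤ T := by
      rw [abs_le]; constructor <;> nlinarith [sq_nonneg (α + β), sq_nonneg (α - β)]
    linarith
  have h2 : |γ * ρ - γ * z / 2| ≤ 7 * T := by
    refine (abs_sub _ _).trans ?_
    have ha : |γ * ρ| ≤ 5 * T := by
      rw [abs_mul]
      calc |γ| * |ρ| ≤ 1 / 2 * (10 * T) := mul_le_mul hγ hρT (abs_nonneg _) (by norm_num)
        _ = 5 * T := by ring
    have hb : |γ * z / 2| ≤ 2 * T := by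
      rw [abs_le]; constructor <;> nlinarith [sq_nonneg (γ + z), sq_nonneg (γ - z)]
    linarith
  rw [e]
  refine (abs_add_le _ _).trans ?_
  rw [abs_mul]
  have hT0 : 0 ≤ T := by positivity
  have := mul_le_mul_of_nonneg_left h1 (abs_nonneg G)
  nlinarith [mul_nonneg (abs_nonneg G) hT0]

lemma sq_div_le_div {x y c Q : ℝ} (hc : 0 < c) (hy : c ≤ y) (hx : x ^ 2 ≤ Q) :
    (x / y) ^ 2 ≤ Q / c ^ 2 := by
  rw [div_pow]
  exact div_le_div₀ ((sq_nonneg x).trans hx) hx (by positivity) (pow_le_pow_left₀ hc.le hy 2)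

lemma abs_div_le_div {x y c Q : ℝ} (hc : 0 < c) (hy : c ≤ y) (hx : |x| ≤ Q) :
    |x / y| ≤ Q / c := by
  rw [abs_div, abs_of_pos (hc.trans_le hy)]
  exact div_le_div₀ ((abs_nonneg x).trans hx) hx hc hy

/-- If the mean `x` grows by `m` and the raw second moment by `e`, the variance grows by `e - 2xm -
m²`. The condition `Q ≤ 1` absorbs `m⁴` into `Q`. -/
lemma sq_variance_increment_le {x m e B Q : ℝ} (hQ : Q ≤ 1) (hx : x ^ 2 ≤ B ^ 2)
    (hm : e ^ 2 + m ^ 2 ≤ Q) : (e - 2 * x * m - m ^ 2) ^ 2 ≤ 2 * (4 + 8 * B ^ 2) * Q := by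
  have hm' : m ^ 2 ≤ Q := by linarith [sq_nonneg e]
  have he' : e ^ 2 ≤ Q := by linarith [sq_nonneg m]
  have h1 : (x * m) ^ 2 ≤ B ^ 2 * Q := by
    rw [mul_pow]
    exact mul_le_mul hx hm' (sq_nonneg _) (sq_nonneg _)
  have h2 : (m ^ 2) ^ 2 ≤ Q := by
    have := mul_le_mul hm' (hm'.trans hQ) (sq_nonneg m) ((sq_nonneg m).trans hm')
    linarith
  have h3 : ∀ u v w : ℝ, (u - v - w) ^ 2 ≤ 3 * (u ^ 2 + v ^ 2 + w ^ 2) := fun u v w => by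
    linarith [sq_nonneg (u + v), sq_nonneg (u + w), sq_nonneg (v - w)]
  have h4 := h3 e (2 * (x * m)) (m ^ 2)
  have h5 : (2 * (x * m)) ^ 2 = 4 * (x * m) ^ 2 := by ring
  have h6 : 0 ≤ B ^ 2 * Q := mul_nonneg (sq_nonneg _) ((sq_nonneg m).trans hm')
  have h7 : 0 ≤ Q := (sq_nonneg m).trans hm'
  rw [h5, ← mul_assoc] at h4
  linarith

lemma sq_covariance_increment_le {a b A D e B Q : ℝ} (hQ : Q ≤ 1) (ha : a ^ 2 ≤ B ^ 2)
    (hb : b ^ 2 ≤ B ^ 2) (hA : A ^ 2 ≤ Q) (hD : D ^ 2 ≤ Q) (he : e ^ 2 ≤ Q) :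
    (e - b * A - a * D - A * D) ^ 2 ≤ 2 * (4 + 8 * B ^ 2) * Q := by
  have h1 : (b * A) ^ 2 ≤ B ^ 2 * Q := by
    rw [mul_pow]; exact mul_le_mul hb hA (sq_nonneg _) (sq_nonneg _)
  have h2 : (a * D) ^ 2 ≤ B ^ 2 * Q := by
    rw [mul_pow]; exact mul_le_mul ha hD (sq_nonneg _) (sq_nonneg _)
  have h3 : (A * D) ^ 2 ≤ Q := by
    rw [mul_pow]
    have := mul_le_mul hA (hD.trans hQ) (sq_nonneg D) ((sq_nonneg A).trans hA)
    linarith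
  have h4 : ∀ u v w z : ℝ, (u - v - w - z) ^ 2 ≤ 4 * (u ^ 2 + v ^ 2 + w ^ 2 + z ^ 2) :=
    fun u v w z => by
      linarith [sq_nonneg (u + v), sq_nonneg (u + w), sq_nonneg (u + z), sq_nonneg (v - w),
        sq_nonneg (v - z), sq_nonneg (w - z)]
  have h5 := h4 e (b * A) (a * D) (A * D)
  have h6 : 0 ≤ B ^ 2 * Q := mul_nonneg (sq_nonneg _) ((sq_nonneg A).trans hA)
  linarith

set_option maxHeartbeats 400000 in
/-- Uniform second-order Taylor bound for the correlation coefficient as a function of the first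
and second moments: `a`, `b` are the means, `p`, `q`, `M` the second central moments, and
`A`, `D`, `exx`, `eyy`, `exy` the increments of the raw moments. -/
lemma exists_corr_moments_expansion {c B : ℝ} (hc : 0 < c) (hB : 0 ≤ B) :
    ∃ C > 0, ∃ η > 0, ∀ a b p q M A D exx eyy exy : ℝ, |a| ≤ B → |b| ≤ B → c ≤ p → c ≤ q →
      |M| ≤ B → A ^ 2 + D ^ 2 + exx ^ 2 + eyy ^ 2 + exy ^ 2 ≤ η →
      |(M + (exy - b * A - a * D) - A * D) /
          √((p + (exx - 2 * a * A) - A ^ 2) * (q + (eyy - 2 * b * D) - D ^ 2))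
        - M / √(p * q) - ((exy - b * A - a * D) / √(p * q) +
          M / √(p * q) * (a / p * A + b / q * D - exx / (2 * p) - eyy / (2 * q)))|
      ≤ C * (A ^ 2 + D ^ 2 + exx ^ 2 + eyy ^ 2 + exy ^ 2) := by
  set k := 4 + 8 * B ^ 2 with hk
  have hk0 : 0 < k := by positivity
  -- The radius makes `2kQ/c² ≤ 1/4`, so all relative increments are at most `1/2`. In the constant,
  -- the first term comes from the ratio bound, the other two from the products `AD`, `A²`, `D²`.
  refine ⟨20 * (1 + B / c) * (6 * k / c ^ 2) + 1 / c + B / c * (1 / c), by positivity,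
    min 1 (c ^ 2 / (8 * k)), by positivity, ?_⟩
  intro a b p q M A D exx eyy exy ha hb hp hq hM hQ
  set Q := A ^ 2 + D ^ 2 + exx ^ 2 + eyy ^ 2 + exy ^ 2 with hQd
  have hQ1 : Q ≤ 1 := hQ.trans (min_le_left _ _)
  have hQ2 : Q ≤ c ^ 2 / (8 * k) := hQ.trans (min_le_right _ _)
  have hQ0 : 0 ≤ Q := by positivity
  have hp0 : 0 < p := hc.trans_le hp
  have hq0 : 0 < q := hc.trans_le hq
  have hA : A ^ 2 ≤ Q := by rw [hQd]; linarith [sq_nonneg D, sq_nonneg exx, sq_nonneg eyy, sq_nonneg exy]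
  have hD : D ^ 2 ≤ Q := by rw [hQd]; linarith [sq_nonneg A, sq_nonneg exx, sq_nonneg eyy, sq_nonneg exy]
  have hAD : A ^ 2 + D ^ 2 ≤ Q := by rw [hQd]; linarith [sq_nonneg exx, sq_nonneg eyy, sq_nonneg exy]
  have hexx : exx ^ 2 + A ^ 2 ≤ Q := by rw [hQd]; linarith [sq_nonneg D, sq_nonneg eyy, sq_nonneg exy]
  have heyy : eyy ^ 2 + D ^ 2 ≤ Q := by rw [hQd]; linarith [sq_nonneg A, sq_nonneg exx, sq_nonneg exy]
  have hexy : exy ^ 2 + A ^ 2 + D ^ 2 ≤ Q := by rw [hQd]; linarith [sq_nonneg exx, sq_nonneg eyy]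
  have ha2 : a ^ 2 ≤ B ^ 2 := by rw [← sq_abs a]; exact pow_le_pow_left₀ (abs_nonneg _) ha 2
  have hb2 : b ^ 2 ≤ B ^ 2 := by rw [← sq_abs b]; exact pow_le_pow_left₀ (abs_nonneg _) hb 2
  have hc2 : ∀ {x m e : ℝ}, x ^ 2 ≤ B ^ 2 → e ^ 2 + m ^ 2 ≤ Q →
      (e - 2 * x * m - m ^ 2) ^ 2 ≤ 2 * k * Q := fun hx hm => sq_variance_increment_le hQ1 hx hm
  have hd : (exy - b * A - a * D - A * D) ^ 2 ≤ 2 * k * Q :=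
    sq_covariance_increment_le hQ1 ha2 hb2 hA hD (by linarith [sq_nonneg A, sq_nonneg D])
  have hσ : c ≤ √(p * q) := Real.le_sqrt_of_sq_le (by rw [sq]; exact mul_le_mul hp hq hc.le hp0.le)
  set σ := √(p * q) with hσd
  have hσ0 : 0 < σ := hc.trans_le hσ
  have hα := sq_div_le_div hc hp (hc2 ha2 hexx)
  have hβ := sq_div_le_div hc hq (hc2 hb2 heyy)
  have hγ := sq_div_le_div hc hσ hd
  set α := (exx - 2 * a * A - A ^ 2) / p with hαd
  set β := (eyy - 2 * b * D - D ^ 2) / q with hβd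
  set γ := (exy - b * A - a * D - A * D) / σ with hγd
  have hsmall : 2 * k * Q / c ^ 2 ≤ (1 / 2) ^ 2 := by
    rw [div_le_iff₀ (by positivity)]
    rw [le_div_iff₀ (by positivity)] at hQ2
    linarith
  have hα1 : |α| ≤ 1 / 2 := abs_le_of_sq_le_sq (hα.trans hsmall) (by norm_num)
  have hβ1 : |β| ≤ 1 / 2 := abs_le_of_sq_le_sq (hβ.trans hsmall) (by norm_num)
  have hγ1 : |γ| ≤ 1 / 2 := abs_le_of_sq_le_sq (hγ.trans hsmall) (by norm_num)
  have hG : |M / σ| ≤ B / c := abs_div_le_div hc hσ hM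
  have hmain := abs_ratio_sub_taylor_le (G := M / σ) hα1 hβ1 hγ1
  set G := M / σ with hGd
  have e1 : (M + (exy - b * A - a * D) - A * D) /
          √((p + (exx - 2 * a * A) - A ^ 2) * (q + (eyy - 2 * b * D) - D ^ 2))
      = (G + γ) / √((1 + α) * (1 + β)) := by
    have : (p + (exx - 2 * a * A) - A ^ 2) * (q + (eyy - 2 * b * D) - D ^ 2)
        = (p * q) * ((1 + α) * (1 + β)) := by
      rw [hαd, hβd]; field_simp; ring
    rw [this, Real.sqrt_mul (by positivity), ← hσd, ← div_div]
    congr 1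
    rw [hGd, hγd]; field_simp; ring
  -- `α`, `β`, `γ` contain parts quadratic in `A`, `D`, absent from the linear form; the last
  -- bracket collects them.
  have e2 : (G + γ) / √((1 + α) * (1 + β)) - G - ((exy - b * A - a * D) / σ +
          G * (a / p * A + b / q * D - exx / (2 * p) - eyy / (2 * q)))
      = ((G + γ) / √((1 + α) * (1 + β)) - (G + γ - G * (α + β) / 2))
        + (-(A * D) / σ + G * ((A ^ 2 / p + D ^ 2 / q) / 2)) := by
    rw [hαd, hβd, hγd]; field_simp; ring
  rw [e1, e2]
  refine (abs_add_le _ _).trans ?_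
  have hb1 : 20 * (1 + |G|) * (α ^ 2 + β ^ 2 + γ ^ 2) ≤ 20 * (1 + B / c) * (6 * k / c ^ 2) * Q := by
    have : α ^ 2 + β ^ 2 + γ ^ 2 ≤ 6 * k / c ^ 2 * Q := by
      have : 6 * k / c ^ 2 * Q = 3 * (2 * k * Q / c ^ 2) := by ring
      linarith
    rw [mul_assoc (20 * (1 + B / c))]
    exact mul_le_mul (by linarith) this (by positivity) (by positivity)
  have hb2' : |-(A * D) / σ| ≤ Q / c := abs_div_le_div hc hσ (by
    rw [abs_le]; constructor <;> linarith [sq_nonneg (A + D), sq_nonneg (A - D)])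
  have hb3 : |G * ((A ^ 2 / p + D ^ 2 / q) / 2)| ≤ B / c * (Q / c) := by
    rw [abs_mul]
    refine mul_le_mul hG ?_ (abs_nonneg _) (by positivity)
    have h1 : A ^ 2 / p ≤ Q / c := div_le_div₀ hQ0 hA hc hp
    have h2 : D ^ 2 / q ≤ Q / c := div_le_div₀ hQ0 hD hc hq
    rw [abs_of_nonneg (by positivity)]
    linarith
  have := abs_add_le (-(A * D) / σ) (G * ((A ^ 2 / p + D ^ 2 / q) / 2))
  calc _ ≤ 20 * (1 + B / c) * (6 * k / c ^ 2) * Q + (Q / c + B / c * (Q / c)) := by linarith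
    _ = _ := by ring

/-! ### The correlation coefficient through raw moments -/

variable {μ μ₁ : Measure (ℝ × ℝ)}

lemma integrable_fst_mul_snd (hx : Integrable (fun p : ℝ × ℝ => p.1 ^ 2) μ)
    (hy : Integrable (fun p : ℝ × ℝ => p.2 ^ 2) μ) :
    Integrable (fun p : ℝ × ℝ => p.1 * p.2) μ := by
  refine (hx.add hy).mono' (by fun_prop) (ae_of_all _ fun p => ?_)
  simp only [Pi.add_apply]
  rw [Real.norm_eq_abs, abs_le]
  constructor <;> nlinarith [sq_nonneg (p.1 + p.2), sq_nonneg (p.1 - p.2), sq_nonneg p.1, sq_nonneg p.2]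

lemma integrable_of_integrable_sq {α : Type*} [MeasurableSpace α] {ν : Measure α}
    [IsFiniteMeasure ν] {f : α → ℝ} (hf : AEStronglyMeasurable f ν)
    (h : Integrable (fun x => f x ^ 2) ν) : Integrable f ν :=
  ((memLp_two_iff_integrable_sq hf).2 h).integrable one_le_two

/-- The second-order central moments and `corrDeriv` all integrate a quadratic polynomial of the
coordinates, so one computation with free coefficients serves them all. -/
lemma integral_quadratic [IsFiniteMeasure μ]
    (hx : Integrable (fun p : ℝ × ℝ => p.1 ^ 2) μ) (hy : Integrable (fun p : ℝ × ℝ => p.2 ^ 2) μ)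
    (c₁ c₂ c₃ c₄ c₅ k : ℝ) :
    Integrable (fun p : ℝ × ℝ => c₁ * (p.1 * p.2) + c₂ * p.1 + c₃ * p.2 + c₄ * p.1 ^ 2
      + c₅ * p.2 ^ 2 + k) μ ∧
    ∫ p, (c₁ * (p.1 * p.2) + c₂ * p.1 + c₃ * p.2 + c₄ * p.1 ^ 2 + c₅ * p.2 ^ 2 + k) ∂μ =
      c₁ * ∫ p, p.1 * p.2 ∂μ + c₂ * meanFst μ + c₃ * meanSnd μ + c₄ * ∫ p, p.1 ^ 2 ∂μ
        + c₅ * ∫ p, p.2 ^ 2 ∂μ + k * μ.real Set.univ := by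
  have h1 : Integrable (fun p : ℝ × ℝ => p.1) μ := integrable_of_integrable_sq (by fun_prop) hx
  have h2 : Integrable (fun p : ℝ × ℝ => p.2) μ := integrable_of_integrable_sq (by fun_prop) hy
  have i1 : Integrable (fun p : ℝ × ℝ => c₁ * (p.1 * p.2)) μ :=
    (integrable_fst_mul_snd hx hy).const_mul _
  have i2 : Integrable (fun p : ℝ × ℝ => c₁ * (p.1 * p.2) + c₂ * p.1) μ := i1.add (h1.const_mul _)
  have i3 : Integrable (fun p : ℝ × ℝ => c₁ * (p.1 * p.2) + c₂ * p.1 + c₃ * p.2) μ :=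
    i2.add (h2.const_mul _)
  have i4 : Integrable (fun p : ℝ × ℝ => c₁ * (p.1 * p.2) + c₂ * p.1 + c₃ * p.2
      + c₄ * p.1 ^ 2) μ := i3.add (hx.const_mul _)
  have i5 : Integrable (fun p : ℝ × ℝ => c₁ * (p.1 * p.2) + c₂ * p.1 + c₃ * p.2
      + c₄ * p.1 ^ 2 + c₅ * p.2 ^ 2) μ := i4.add (hy.const_mul _)
  refine ⟨i5.add (integrable_const _), ?_⟩
  rw [integral_add i5 (integrable_const _), integral_add i4 (hy.const_mul _),
    integral_add i3 (hx.const_mul _), integral_add i2 (h2.const_mul _),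
    integral_add i1 (h1.const_mul _)]
  simp only [integral_const_mul, integral_const, smul_eq_mul, meanFst, meanSnd]
  ring

lemma centralMoment_two_zero [IsProbabilityMeasure μ]
    (hx : Integrable (fun p : ℝ × ℝ => p.1 ^ 2) μ) (hy : Integrable (fun p : ℝ × ℝ => p.2 ^ 2) μ) :
    centralMoment 2 0 μ = ∫ p, p.1 ^ 2 ∂μ - meanFst μ ^ 2 := by
  have e : ∀ p : ℝ × ℝ, (p.1 - meanFst μ) ^ 2 * (p.2 - meanSnd μ) ^ 0 =
      0 * (p.1 * p.2) + (-2 * meanFst μ) * p.1 + 0 * p.2 + 1 * p.1 ^ 2 + 0 * p.2 ^ 2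
        + meanFst μ ^ 2 := fun p => by ring
  simp_rw [centralMoment, e]
  rw [(integral_quadratic hx hy _ _ _ _ _ _).2, probReal_univ]
  ring

lemma centralMoment_zero_two [IsProbabilityMeasure μ]
    (hx : Integrable (fun p : ℝ × ℝ => p.1 ^ 2) μ) (hy : Integrable (fun p : ℝ × ℝ => p.2 ^ 2) μ) :
    centralMoment 0 2 μ = ∫ p, p.2 ^ 2 ∂μ - meanSnd μ ^ 2 := by
  have e : ∀ p : ℝ × ℝ, (p.1 - meanFst μ) ^ 0 * (p.2 - meanSnd μ) ^ 2 =
      0 * (p.1 * p.2) + 0 * p.1 + (-2 * meanSnd μ) * p.2 + 0 * p.1 ^ 2 + 1 * p.2 ^ 2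
        + meanSnd μ ^ 2 := fun p => by ring
  simp_rw [centralMoment, e]
  rw [(integral_quadratic hx hy _ _ _ _ _ _).2, probReal_univ]
  ring

lemma centralMoment_one_one [IsProbabilityMeasure μ]
    (hx : Integrable (fun p : ℝ × ℝ => p.1 ^ 2) μ) (hy : Integrable (fun p : ℝ × ℝ => p.2 ^ 2) μ) :
    centralMoment 1 1 μ = ∫ p, p.1 * p.2 ∂μ - meanFst μ * meanSnd μ := by
  have e : ∀ p : ℝ × ℝ, (p.1 - meanFst μ) ^ 1 * (p.2 - meanSnd μ) ^ 1 =
      1 * (p.1 * p.2) + (-meanSnd μ) * p.1 + (-meanFst μ) * p.2 + 0 * p.1 ^ 2 + 0 * p.2 ^ 2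
        + meanFst μ * meanSnd μ := fun p => by ring
  simp_rw [centralMoment, e]
  rw [(integral_quadratic hx hy _ _ _ _ _ _).2, probReal_univ]
  ring

lemma corrDeriv_eq_quadratic (μ : Measure (ℝ × ℝ)) :
    corrDeriv μ = fun p : ℝ × ℝ => 1 / √(centralMoment 2 0 μ * centralMoment 0 2 μ) * (p.1 * p.2)
      + (corr μ * meanFst μ / centralMoment 2 0 μ
          - meanSnd μ / √(centralMoment 2 0 μ * centralMoment 0 2 μ)) * p.1
      + (corr μ * meanSnd μ / centralMoment 0 2 μ
          - meanFst μ / √(centralMoment 2 0 μ * centralMoment 0 2 μ)) * p.2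
      + (-corr μ / (2 * centralMoment 2 0 μ)) * p.1 ^ 2
      + (-corr μ / (2 * centralMoment 0 2 μ)) * p.2 ^ 2 + 0 := by
  ext p
  unfold corrDeriv
  ring

lemma integrable_corrDeriv [IsFiniteMeasure μ₁]
    (hx : Integrable (fun p : ℝ × ℝ => p.1 ^ 2) μ₁)
    (hy : Integrable (fun p : ℝ × ℝ => p.2 ^ 2) μ₁) : Integrable (corrDeriv μ) μ₁ := by
  rw [corrDeriv_eq_quadratic]
  exact (integral_quadratic hx hy _ _ _ _ _ _).1

lemma integral_corrDeriv [IsFiniteMeasure μ₁]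
    (hx : Integrable (fun p : ℝ × ℝ => p.1 ^ 2) μ₁)
    (hy : Integrable (fun p : ℝ × ℝ => p.2 ^ 2) μ₁) :
    ∫ p, corrDeriv μ p ∂μ₁ =
      (∫ p, p.1 * p.2 ∂μ₁ - meanSnd μ * meanFst μ₁ - meanFst μ * meanSnd μ₁) /
        √(centralMoment 2 0 μ * centralMoment 0 2 μ)
      + corr μ * (meanFst μ / centralMoment 2 0 μ * meanFst μ₁
        + meanSnd μ / centralMoment 0 2 μ * meanSnd μ₁
        - (∫ p, p.1 ^ 2 ∂μ₁) / (2 * centralMoment 2 0 μ)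
        - (∫ p, p.2 ^ 2 ∂μ₁) / (2 * centralMoment 0 2 μ)) := by
  rw [corrDeriv_eq_quadratic, (integral_quadratic hx hy _ _ _ _ _ _).2]
  ring

/-- The squared distance of two laws in terms of their first and second moments. -/
def momentDistSq (μ μ₁ : Measure (ℝ × ℝ)) : ℝ :=
  (∫ p, p.1 ∂μ₁ - ∫ p, p.1 ∂μ) ^ 2 + (∫ p, p.2 ∂μ₁ - ∫ p, p.2 ∂μ) ^ 2
    + (∫ p, p.1 ^ 2 ∂μ₁ - ∫ p, p.1 ^ 2 ∂μ) ^ 2 + (∫ p, p.2 ^ 2 ∂μ₁ - ∫ p, p.2 ^ 2 ∂μ) ^ 2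
    + (∫ p, p.1 * p.2 ∂μ₁ - ∫ p, p.1 * p.2 ∂μ) ^ 2

/-- The linearization error of the correlation coefficient is quadratic in the distance of
the moments, uniformly over laws with bounded moments and variances bounded below. -/
lemma exists_corr_expansion {c B : ℝ} (hc : 0 < c) (hB : 0 ≤ B) :
    ∃ C > 0, ∃ η > 0, ∀ μ μ₁ : Measure (ℝ × ℝ), IsProbabilityMeasure μ → IsProbabilityMeasure μ₁ →
      Integrable (fun p : ℝ × ℝ => p.1 ^ 2) μ → Integrable (fun p : ℝ × ℝ => p.2 ^ 2) μ →
      Integrable (fun p : ℝ × ℝ => p.1 ^ 2) μ₁ → Integrable (fun p : ℝ × ℝ => p.2 ^ 2) μ₁ →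
      |meanFst μ| ≤ B → |meanSnd μ| ≤ B → c ≤ centralMoment 2 0 μ → c ≤ centralMoment 0 2 μ →
      |centralMoment 1 1 μ| ≤ B → momentDistSq μ μ₁ ≤ η →
      |corr μ₁ - corr μ - (∫ p, corrDeriv μ p ∂μ₁ - ∫ p, corrDeriv μ p ∂μ)|
        ≤ C * momentDistSq μ μ₁ := by
  obtain ⟨C, hC, η, hη, h⟩ := exists_corr_moments_expansion hc hB
  refine ⟨C, hC, η, hη, ?_⟩
  intro μ μ₁ _ _ hx hy hx₁ hy₁ ha hb hp hq hM hQ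
  refine le_trans (le_of_eq ?_) (h (meanFst μ) (meanSnd μ) (centralMoment 2 0 μ)
    (centralMoment 0 2 μ) (centralMoment 1 1 μ) (meanFst μ₁ - meanFst μ) (meanSnd μ₁ - meanSnd μ)
    (∫ p, p.1 ^ 2 ∂μ₁ - ∫ p, p.1 ^ 2 ∂μ) (∫ p, p.2 ^ 2 ∂μ₁ - ∫ p, p.2 ^ 2 ∂μ)
    (∫ p, p.1 * p.2 ∂μ₁ - ∫ p, p.1 * p.2 ∂μ) ha hb hp hq hM hQ)
  rw [integral_corrDeriv hx hy, integral_corrDeriv hx₁ hy₁]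
  have e1 : corr μ₁ = (centralMoment 1 1 μ + (∫ p, p.1 * p.2 ∂μ₁ - ∫ p, p.1 * p.2 ∂μ
        - meanSnd μ * (meanFst μ₁ - meanFst μ) - meanFst μ * (meanSnd μ₁ - meanSnd μ))
        - (meanFst μ₁ - meanFst μ) * (meanSnd μ₁ - meanSnd μ)) /
      √((centralMoment 2 0 μ + (∫ p, p.1 ^ 2 ∂μ₁ - ∫ p, p.1 ^ 2 ∂μ
          - 2 * meanFst μ * (meanFst μ₁ - meanFst μ)) - (meanFst μ₁ - meanFst μ) ^ 2) *
        (centralMoment 0 2 μ + (∫ p, p.2 ^ 2 ∂μ₁ - ∫ p, p.2 ^ 2 ∂μ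
          - 2 * meanSnd μ * (meanSnd μ₁ - meanSnd μ)) - (meanSnd μ₁ - meanSnd μ) ^ 2)) := by
    rw [corr, centralMoment_two_zero hx₁ hy₁, centralMoment_zero_two hx₁ hy₁,
      centralMoment_one_one hx₁ hy₁, centralMoment_two_zero hx hy, centralMoment_zero_two hx hy,
      centralMoment_one_one hx hy]
    congr 1
    · ring
    · congr 1; ring
  rw [e1]
  congr 1
  unfold corr
  ring

/-! ### The statistical derivative -/

/-- The restriction on `t` keeps both weights nonnegative, where `ENNReal.ofReal` does not truncate.
-/
lemma integral_segmentPoint {f : ℝ × ℝ → ℝ} (h : Integrable f μ) (h₁ : Integrable f μ₁) {t : ℝ}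
    (ht : t ∈ Set.Icc (0 : ℝ) 1) :
    ∫ p, f p ∂(segmentPoint μ μ₁ t) = (1 - t) * ∫ p, f p ∂μ + t * ∫ p, f p ∂μ₁ := by
  rw [segmentPoint, integral_add_measure (h.smul_measure ENNReal.ofReal_ne_top)
    (h₁.smul_measure ENNReal.ofReal_ne_top), integral_smul_measure, integral_smul_measure,
    ENNReal.toReal_ofReal ht.1, ENNReal.toReal_ofReal (by linarith [ht.2])]
  simp

lemma isProbabilityMeasure_segmentPoint [IsProbabilityMeasure μ] [IsProbabilityMeasure μ₁] {t : ℝ}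
    (ht : t ∈ Set.Icc (0 : ℝ) 1) : IsProbabilityMeasure (segmentPoint μ μ₁ t) := by
  constructor
  simp only [segmentPoint, Measure.coe_add, Measure.coe_smul, Pi.add_apply, Pi.smul_apply,
    measure_univ, smul_eq_mul, mul_one]
  rw [← ENNReal.ofReal_add (by linarith [ht.2]) ht.1]
  simp

lemma integrable_segmentPoint {f : ℝ × ℝ → ℝ} (h : Integrable f μ) (h₁ : Integrable f μ₁) (t : ℝ) :
    Integrable f (segmentPoint μ μ₁ t) :=
  (h.smul_measure ENNReal.ofReal_ne_top).add_measure (h₁.smul_measure ENNReal.ofReal_ne_top)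

/-- `corrDeriv μ` is the statistical derivative of the correlation coefficient. -/
theorem hasStatDeriv_corr (hμ : μ ∈ corrDomain) :
    HasStatDeriv corrDomain corr μ (corrDeriv μ) := by
  obtain ⟨hp, hx, hy, h20, h02⟩ := hμ
  refine ⟨⟨hp, hx, hy, h20, h02⟩, integrable_corrDeriv hx hy, ?_⟩
  rintro V ⟨hpV, hxV, hyV, -, -⟩
  refine ⟨integrable_corrDeriv hxV hyV, ?_⟩
  have ix : Integrable (fun p : ℝ × ℝ => p.1) μ := integrable_of_integrable_sq (by fun_prop) hx
  have iy : Integrable (fun p : ℝ × ℝ => p.2) μ := integrable_of_integrable_sq (by fun_prop) hy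
  have ixV : Integrable (fun p : ℝ × ℝ => p.1) V := integrable_of_integrable_sq (by fun_prop) hxV
  have iyV : Integrable (fun p : ℝ × ℝ => p.2) V := integrable_of_integrable_sq (by fun_prop) hyV
  obtain ⟨C, hC, η, hη, h⟩ := exists_corr_expansion (lt_min h20 h02)
    (B := max (max |meanFst μ| |meanSnd μ|) |centralMoment 1 1 μ|) (by positivity)
  have hQ : ∀ t ∈ Set.Icc (0 : ℝ) 1, momentDistSq μ (segmentPoint μ V t)
      = t ^ 2 * momentDistSq μ V := by
    intro t ht
    unfold momentDistSq
    rw [integral_segmentPoint ix ixV ht, integral_segmentPoint iy iyV ht,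
      integral_segmentPoint hx hxV ht, integral_segmentPoint hy hyV ht,
      integral_segmentPoint (integrable_fst_mul_snd hx hy) (integrable_fst_mul_snd hxV hyV) ht]
    ring
  have hseg0 : segmentPoint μ V 0 = μ := by simp [segmentPoint]
  rw [hasDerivWithinAt_iff_isLittleO]
  -- The squared moment distance along the segment is exactly `t²` times a constant, so the uniform
  -- expansion gives an `O(t²)` error.
  have hO : (fun t : ℝ => corr (segmentPoint μ V t) - corr (segmentPoint μ V 0)
      - (t - 0) • ((∫ y, corrDeriv μ y ∂V) - ∫ y, corrDeriv μ y ∂μ))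
      =O[𝓝[Set.Icc 0 1] 0] fun t : ℝ => t ^ 2 := by
    refine Asymptotics.IsBigO.of_bound (C * momentDistSq μ V) ?_
    have hsmall : ∀ᶠ t : ℝ in 𝓝[Set.Icc 0 1] 0, t ^ 2 * momentDistSq μ V ≤ η := by
      have : Tendsto (fun t : ℝ => t ^ 2 * momentDistSq μ V) (𝓝[Set.Icc 0 1] 0) (𝓝 0) := by
        have h : Continuous fun t : ℝ => t ^ 2 * momentDistSq μ V := by fun_prop
        simpa using (h.tendsto 0).mono_left nhdsWithin_le_nhds
      exact this.eventually (eventually_le_nhds hη)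
    filter_upwards [hsmall, self_mem_nhdsWithin] with t ht1 ht
    have := isProbabilityMeasure_segmentPoint (μ := μ) (μ₁ := V) ht
    have hh := h μ (segmentPoint μ V t) hp this hx hy (integrable_segmentPoint hx hxV t)
      (integrable_segmentPoint hy hyV t) ((le_max_left _ _).trans (le_max_left _ _))
      ((le_max_right _ _).trans (le_max_left _ _)) (min_le_left _ _) (min_le_right _ _)
      (le_max_right _ _) (by rw [hQ t ht]; exact ht1)
    rw [hQ t ht, integral_segmentPoint (integrable_corrDeriv hx hy) (integrable_corrDeriv hxV hyV) ht]
      at hh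
    rw [hseg0, Real.norm_eq_abs, Real.norm_eq_abs, abs_of_nonneg (sq_nonneg t)]
    refine le_trans (le_of_eq ?_) (hh.trans (le_of_eq (by ring)))
    congr 1
    rw [smul_eq_mul]; ring
  refine hO.trans_isLittleO ?_
  have : (fun t : ℝ => t ^ 2) =o[𝓝 0] fun t => t - 0 := by
    simpa using Asymptotics.isLittleO_pow_id (𝕜 := ℝ) (n := 2) (by norm_num)
  exact this.mono nhdsWithin_le_nhds

end StatFun

namespace StatFun

/-! ### Sixth moments from uniform tails -/

/-- Layer-cake formula: on `(0, N]` the probability is at most one, and beyond `N` the tail bound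
reduces `t⁵ · P(|f| > t)` to `K t^(-1-ε)`. The constant depends only on `ε`, `N`, `K`. -/
lemma exists_lintegral_pow_six_le {ε N : ℝ} (K : ℝ) (hε : 0 < ε) (hN : 0 < N) :
    ∃ C : ℝ≥0∞, C < ⊤ ∧ ∀ (μ : Measure (ℝ × ℝ)) (f : ℝ × ℝ → ℝ), IsProbabilityMeasure μ →
      Measurable f → (∀ t > N, t ^ (6 + ε) * μ.real {p | t < |f p|} ≤ K) →
      ∫⁻ p, ENNReal.ofReal (|f p| ^ 6) ∂μ ≤ C := by
  have h1 : IntegrableOn (fun t : ℝ => t ^ (5 : ℝ)) (Set.Ioc 0 N) := by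
    have : IntegrableOn (fun t : ℝ => t ^ (5 : ℕ)) (Set.Ioc 0 N) :=
      (continuous_pow 5).integrableOn_Icc.mono_set Set.Ioc_subset_Icc_self
    exact_mod_cast this
  have h2 : IntegrableOn (fun t : ℝ => K * t ^ (-1 - ε)) (Set.Ioi N) :=
    (integrableOn_Ioi_rpow_of_lt (by linarith) hN).const_mul K
  refine ⟨ENNReal.ofReal 6 * ((∫⁻ t in Set.Ioc 0 N, ENNReal.ofReal (t ^ (5 : ℝ))) +
    ∫⁻ t in Set.Ioi N, ENNReal.ofReal (K * t ^ (-1 - ε))), ?_, ?_⟩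
  · exact ENNReal.mul_lt_top ENNReal.ofReal_lt_top
      (ENNReal.add_lt_top.2 ⟨h1.lintegral_lt_top, h2.lintegral_lt_top⟩)
  · intro μ f _ hf htail
    have hl := lintegral_rpow_eq_lintegral_meas_lt_mul μ (f := fun p => |f p|)
      (ae_of_all _ fun p => abs_nonneg _) hf.abs.aemeasurable (p := 6) (by norm_num)
    have e : ∀ p, |f p| ^ (6 : ℝ) = |f p| ^ 6 := fun p => by norm_cast
    simp_rw [e] at hl
    rw [hl, ← Set.Ioc_union_Ioi_eq_Ioi hN.le,
      lintegral_union measurableSet_Ioi (Set.Ioc_disjoint_Ioi le_rfl)]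
    refine mul_le_mul' le_rfl (add_le_add ?_ ?_)
    · refine lintegral_mono fun t => ?_
      rw [show (6 : ℝ) - 1 = 5 by norm_num]
      exact mul_le_of_le_one_left zero_le prob_le_one
    · refine setLIntegral_mono' measurableSet_Ioi fun t ht => ?_
      have ht0 : 0 < t := hN.trans ht
      rw [← ofReal_measureReal, ← ENNReal.ofReal_mul measureReal_nonneg]
      refine ENNReal.ofReal_le_ofReal ?_
      have h := mul_le_mul_of_nonneg_right (htail t ht) (Real.rpow_nonneg ht0.le (-1 - ε))
      refine le_trans (le_of_eq ?_) h
      rw [mul_right_comm, ← Real.rpow_add ht0, mul_comm]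
      congr 2
      ring

/-- The weight `1 + x ^ 6 + y ^ 6`, which dominates all functions of the coordinates used here. -/
def sixthWeight (p : ℝ × ℝ) : ℝ := 1 + p.1 ^ 6 + p.2 ^ 6

lemma sixthWeight_nonneg (p : ℝ × ℝ) : 0 ≤ sixthWeight p := by
  unfold sixthWeight; positivity

/-- Uniformly tailed laws have uniformly bounded sixth moments. -/
lemma exists_integral_sixthWeight_le {V' : ℕ → Measure (ℝ × ℝ)} [∀ ν, IsProbabilityMeasure (V' ν)]
    {ε N K : ℝ} (hε : 0 < ε) (hN : 0 < N) (htail : UniformTail V' (6 + ε) N K) :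
    ∃ B : ℝ, 0 ≤ B ∧ ∀ ν, Integrable sixthWeight (V' ν) ∧ ∫ p, sixthWeight p ∂(V' ν) ≤ B := by
  -- The factor `2` accounts for the left and the right tail of a coordinate.
  obtain ⟨C, hC, h⟩ := exists_lintegral_pow_six_le (2 * K) hε hN
  have key : ∀ ν (f : ℝ × ℝ → ℝ), Measurable f →
      (∀ t > N, (V' ν).real {p | t < |f p|} ≤
        (V' ν).real {p | f p ≤ -t} + (V' ν).real {p | t < f p}) := by
    intro ν f hf t ht
    refine (measureReal_mono ?_).trans (measureReal_union_le _ _)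
    intro p hp
    have hp' : t < |f p| := hp
    rcases lt_abs.1 hp' with h | h
    · exact Or.inr h
    · exact Or.inl (show f p ≤ -t by linarith)
  -- Both right tails lie in the complement of the quadrant measured by `distFun`.
  have hcompl : ∀ ν (t : ℝ), (V' ν).real {p | t < p.1} ≤ 1 - distFun (V' ν) t t ∧
      (V' ν).real {p | t < p.2} ≤ 1 - distFun (V' ν) t t := by
    intro ν t
    have hm : MeasurableSet {p : ℝ × ℝ | (p.1 : EReal) ≤ t ∧ (p.2 : EReal) ≤ t} := by
      simp only [EReal.coe_le_coe_iff]
      exact (measurableSet_le measurable_fst measurable_const).inter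
        (measurableSet_le measurable_snd measurable_const)
    rw [distFun, ← probReal_compl_eq_one_sub hm]
    constructor <;>
    · refine measureReal_mono fun p (hp : t < _) => ?_
      simp only [Set.mem_compl_iff, Set.mem_ofPred_eq, EReal.coe_le_coe_iff, not_and_or, not_le]
      tauto
  have hint : ∀ ν (f : ℝ × ℝ → ℝ), Measurable f →
      (∀ t > N, t ^ (6 + ε) * (V' ν).real {p | t < |f p|} ≤ 2 * K) →
      Integrable (fun p => f p ^ 6) (V' ν) ∧ ∫ p, f p ^ 6 ∂(V' ν) ≤ C.toReal := by
    intro ν f hf ht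
    have hle := h (V' ν) f inferInstance hf ht
    have e : ∀ p, |f p| ^ 6 = f p ^ 6 := fun p => Even.pow_abs (by decide) _
    simp_rw [e] at hle
    have hnn : 0 ≤ᵐ[V' ν] fun p => f p ^ 6 := ae_of_all _ fun p => Even.pow_nonneg (by decide) _
    have hm : AEStronglyMeasurable (fun p => f p ^ 6) (V' ν) := (hf.pow_const 6).aestronglyMeasurable
    refine ⟨⟨hm, ?_⟩, ?_⟩
    · rw [hasFiniteIntegral_iff_ofReal hnn]
      exact hle.trans_lt hC
    · rw [integral_eq_lintegral_of_nonneg_ae hnn hm]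
      exact ENNReal.toReal_mono hC.ne hle
  have h1 : ∀ ν, Integrable (fun p : ℝ × ℝ => p.1 ^ 6) (V' ν) ∧ ∫ p, p.1 ^ 6 ∂(V' ν) ≤ C.toReal := by
    refine fun ν => hint ν (fun p => p.1) measurable_fst fun t ht => ?_
    have ht0 : 0 ≤ t ^ (6 + ε) := Real.rpow_nonneg (hN.trans ht).le _
    obtain ⟨ha, -, hc⟩ := htail ν t ht
    have hd : distFun (V' ν) ((-t : ℝ) : EReal) ⊤ = (V' ν).real {p | p.1 ≤ -t} := by
      simp only [distFun, le_top, and_true, EReal.coe_le_coe_iff]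
    rw [hd] at ha
    have := mul_le_mul_of_nonneg_left (key ν (fun p => p.1) measurable_fst t ht) ht0
    have h3 := mul_le_mul_of_nonneg_left (hcompl ν t).1 ht0
    linarith
  have h2 : ∀ ν, Integrable (fun p : ℝ × ℝ => p.2 ^ 6) (V' ν) ∧ ∫ p, p.2 ^ 6 ∂(V' ν) ≤ C.toReal := by
    refine fun ν => hint ν (fun p => p.2) measurable_snd fun t ht => ?_
    have ht0 : 0 ≤ t ^ (6 + ε) := Real.rpow_nonneg (hN.trans ht).le _
    obtain ⟨-, ha, hc⟩ := htail ν t ht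
    have hd : distFun (V' ν) ⊤ ((-t : ℝ) : EReal) = (V' ν).real {p | p.2 ≤ -t} := by
      simp only [distFun, le_top, true_and, EReal.coe_le_coe_iff]
    rw [hd] at ha
    have := mul_le_mul_of_nonneg_left (key ν (fun p => p.2) measurable_snd t ht) ht0
    have h3 := mul_le_mul_of_nonneg_left (hcompl ν t).2 ht0
    linarith
  refine ⟨1 + C.toReal + C.toReal, by positivity, fun ν => ?_⟩
  have hi : Integrable (fun p : ℝ × ℝ => 1 + p.1 ^ 6) (V' ν) := (integrable_const _).add (h1 ν).1
  refine ⟨hi.add (h2 ν).1, ?_⟩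
  unfold sixthWeight
  rw [integral_add hi (h2 ν).1, integral_add (integrable_const _) (h1 ν).1]
  simp only [integral_const, probReal_univ, smul_eq_mul, mul_one]
  linarith [(h1 ν).2, (h2 ν).2]

/-! ### Pointwise domination by the sixth-power weight. -/

lemma sq_le_one_add_pow_six (x : ℝ) : x ^ 2 ≤ 1 + x ^ 6 := by
  nlinarith [sq_nonneg (x ^ 2 - 1), sq_nonneg x, mul_nonneg (sq_nonneg x) (sq_nonneg (x ^ 2 - 1))]

lemma pow_four_le (x : ℝ) : x ^ 4 ≤ 1 + x ^ 6 := by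
  nlinarith [sq_nonneg (x ^ 2 - 1), sq_nonneg x, mul_nonneg (sq_nonneg x) (sq_nonneg (x ^ 2 - 1))]

lemma one_add_sq_add_sq_le_sixthWeight (p : ℝ × ℝ) :
    1 + p.1 ^ 2 + p.2 ^ 2 ≤ 3 * sixthWeight p := by
  have h := sq_le_one_add_pow_six
  have h1 : 0 ≤ p.1 ^ 6 := by positivity
  have h2 : 0 ≤ p.2 ^ 6 := by positivity
  unfold sixthWeight
  linarith [h p.1, h p.2]

lemma one_add_sq_add_sq_pow_three_le (p : ℝ × ℝ) :
    (1 + p.1 ^ 2 + p.2 ^ 2) ^ 3 ≤ 9 * sixthWeight p := by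
  have h : ∀ a b c : ℝ, 0 ≤ a → 0 ≤ b → 0 ≤ c → (a + b + c) ^ 3 ≤ 9 * (a ^ 3 + b ^ 3 + c ^ 3) := by
    intro a b c ha hb hc
    nlinarith [mul_nonneg (add_nonneg ha hb) (sq_nonneg (a - b)),
      mul_nonneg (add_nonneg ha hc) (sq_nonneg (a - c)),
      mul_nonneg (add_nonneg hb hc) (sq_nonneg (b - c)), mul_nonneg ha (sq_nonneg (b - c)),
      mul_nonneg hb (sq_nonneg (a - c)), mul_nonneg hc (sq_nonneg (a - b))]
  have := h 1 (p.1 ^ 2) (p.2 ^ 2) zero_le_one (sq_nonneg _) (sq_nonneg _)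
  unfold sixthWeight
  linarith

lemma sq_le_sixthWeight (p : ℝ × ℝ) : p.1 ^ 2 ≤ sixthWeight p ∧ p.2 ^ 2 ≤ sixthWeight p ∧
    (p.1 ^ 2) ^ 2 ≤ sixthWeight p ∧ (p.2 ^ 2) ^ 2 ≤ sixthWeight p ∧
    (p.1 * p.2) ^ 2 ≤ sixthWeight p := by
  have h := sq_le_one_add_pow_six
  have h1 : 0 ≤ p.1 ^ 6 := by positivity
  have h2 : 0 ≤ p.2 ^ 6 := by positivity
  have h3 := pow_four_le p.1
  have h4 := pow_four_le p.2
  have e1 : (p.1 ^ 2) ^ 2 = p.1 ^ 4 := by ring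
  have e2 : (p.2 ^ 2) ^ 2 = p.2 ^ 4 := by ring
  unfold sixthWeight
  refine ⟨by linarith [h p.1], by linarith [h p.2], by linarith, by linarith, ?_⟩
  nlinarith [sq_nonneg (p.1 ^ 2 - p.2 ^ 2)]

lemma integrable_of_le_sixthWeight {μ : Measure (ℝ × ℝ)} (h : Integrable sixthWeight μ) {f : ℝ × ℝ → ℝ}
    (hf : Measurable f) (h0 : ∀ p, 0 ≤ f p) (hle : ∀ p, f p ≤ sixthWeight p) :
    Integrable f μ ∧ ∫ p, f p ∂μ ≤ ∫ p, sixthWeight p ∂μ := by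
  have : Integrable f μ := h.mono' hf.aestronglyMeasurable
    (ae_of_all _ fun p => by rw [Real.norm_eq_abs, abs_of_nonneg (h0 p)]; exact hle p)
  exact ⟨this, integral_mono this h hle⟩

/-- Third absolute central moments under a law with a sixth moment, for a function of at most
quadratic growth. -/
lemma integral_abs_sub_integral_pow_three_le {μ : Measure (ℝ × ℝ)} {B L : ℝ} (hL : 0 ≤ L)
    (hW : Integrable sixthWeight μ) (hWB : ∫ p, sixthWeight p ∂μ ≤ B) {f : ℝ × ℝ → ℝ}
    (hf : Measurable f) (h : ∀ p, |f p| ≤ L * (1 + p.1 ^ 2 + p.2 ^ 2)) :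
    Integrable f μ ∧ Integrable (fun p => |f p - ∫ z, f z ∂μ| ^ 3) μ ∧
    ∫ p, |f p - ∫ z, f z ∂μ| ^ 3 ∂μ ≤ 9 * (L + 3 * L * B) ^ 3 * B := by
  have hf3 : ∀ p, |f p| ≤ 3 * L * sixthWeight p := fun p => (h p).trans (by
    have := mul_le_mul_of_nonneg_left (one_add_sq_add_sq_le_sixthWeight p) hL
    linarith)
  have hi : Integrable f μ := (hW.const_mul (3 * L)).mono' hf.aestronglyMeasurable
    (ae_of_all _ hf3)
  have hB : 0 ≤ B := (integral_nonneg sixthWeight_nonneg).trans hWB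
  set m := ∫ z, f z ∂μ
  have hm : |m| ≤ 3 * L * B := by
    have h1 : ‖m‖ ≤ ∫ p, 3 * L * sixthWeight p ∂μ :=
      norm_integral_le_of_norm_le (hW.const_mul (3 * L)) (ae_of_all _ hf3)
    rw [integral_const_mul] at h1
    exact h1.trans (mul_le_mul_of_nonneg_left hWB (by positivity))
  have hb : ∀ p, |f p - m| ^ 3 ≤ 9 * (L + 3 * L * B) ^ 3 * sixthWeight p := by
    intro p
    -- The mean is absorbed into the growth constant because `1 + x² + y² ≥ 1`.
    have h1 : |f p - m| ≤ (L + 3 * L * B) * (1 + p.1 ^ 2 + p.2 ^ 2) := by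
      have h2 := abs_sub (f p) m
      have h3 : 0 ≤ 3 * L * B * (p.1 ^ 2 + p.2 ^ 2) := by positivity
      have := h p
      linarith
    calc |f p - m| ^ 3 ≤ ((L + 3 * L * B) * (1 + p.1 ^ 2 + p.2 ^ 2)) ^ 3 :=
          pow_le_pow_left₀ (abs_nonneg _) h1 3
      _ = (L + 3 * L * B) ^ 3 * (1 + p.1 ^ 2 + p.2 ^ 2) ^ 3 := mul_pow _ _ _
      _ ≤ (L + 3 * L * B) ^ 3 * (9 * sixthWeight p) :=
          mul_le_mul_of_nonneg_left (one_add_sq_add_sq_pow_three_le p) (by positivity)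
      _ = _ := by ring
  have hi3 : Integrable (fun p => |f p - m| ^ 3) μ :=
    (hW.const_mul (9 * (L + 3 * L * B) ^ 3)).mono'
      ((hf.sub_const m).abs.pow_const 3).aestronglyMeasurable
      (ae_of_all _ fun p => by
        rw [Real.norm_eq_abs, abs_of_nonneg (by positivity)]; exact hb p)
  refine ⟨hi, hi3, (integral_mono hi3 (hW.const_mul _) hb).trans ?_⟩
  rw [integral_const_mul]
  exact mul_le_mul_of_nonneg_left hWB (by positivity)

/-! ### Mean laws -/

variable {V' : ℕ → Measure (ℝ × ℝ)}

lemma integrable_meanLaw {f : ℝ × ℝ → ℝ} (h : ∀ ν, Integrable f (V' ν)) (n : ℕ) :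
    Integrable f (meanLaw V' n) := by
  -- For `n = 0` the scalar is `⊤`, but it multiplies an empty sum, so the measure is zero.
  rcases Nat.eq_zero_or_pos n with rfl | hn
  · simp [meanLaw]
  · exact (integrable_finsetSum_measure.2 fun k _ => h k).smul_measure
      (ENNReal.inv_ne_top.2 (by exact_mod_cast hn.ne'))

lemma integral_meanLaw {f : ℝ × ℝ → ℝ} (h : ∀ ν, Integrable f (V' ν)) (n : ℕ) :
    ∫ p, f p ∂(meanLaw V' n) = (n : ℝ)⁻¹ * ∑ k ∈ Finset.range n, ∫ p, f p ∂(V' k) := by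
  rw [meanLaw, integral_smul_measure, integral_finsetSum_measure fun k _ => h k]
  simp

lemma isProbabilityMeasure_meanLaw [∀ ν, IsProbabilityMeasure (V' ν)] {n : ℕ} (hn : 0 < n) :
    IsProbabilityMeasure (meanLaw V' n) := by
  constructor
  simp only [meanLaw, Measure.coe_smul, Measure.coe_finsetSum, Pi.smul_apply, Finset.sum_apply,
    measure_univ, Finset.sum_const, Finset.card_range, smul_eq_mul, nsmul_eq_mul, mul_one]
  exact ENNReal.inv_mul_cancel (by exact_mod_cast hn.ne') (ENNReal.natCast_ne_top n)

lemma integral_meanLaw_le {f : ℝ × ℝ → ℝ} (h : ∀ ν, Integrable f (V' ν)) {B : ℝ}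
    (hB : ∀ ν, ∫ p, f p ∂(V' ν) ≤ B) {n : ℕ} (hn : 0 < n) :
    ∫ p, f p ∂(meanLaw V' n) ≤ B := by
  have hn' : (0 : ℝ) < n := by exact_mod_cast hn
  rw [integral_meanLaw h, inv_mul_le_iff₀ hn']
  simpa using Finset.sum_le_sum fun k (_ : k ∈ Finset.range n) => hB k

/-- The empirical law is the mean law of Dirac masses. -/
lemma integral_empLaw (f : ℝ × ℝ → ℝ) (x : ℕ → ℝ × ℝ) (n : ℕ) :
    ∫ p, f p ∂(empLaw x n) = (n : ℝ)⁻¹ * ∑ k ∈ Finset.range n, f (x k) := by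
  have := integral_meanLaw (V' := fun ν => Measure.dirac (x ν)) (f := f)
    (fun ν => integrable_dirac (by simp)) n
  simp only [integral_dirac] at this
  exact this

lemma integrable_empLaw (f : ℝ × ℝ → ℝ) (x : ℕ → ℝ × ℝ) (n : ℕ) : Integrable f (empLaw x n) :=
  integrable_meanLaw (V' := fun ν => Measure.dirac (x ν)) (fun ν => integrable_dirac (by simp)) n

lemma isProbabilityMeasure_empLaw (x : ℕ → ℝ × ℝ) {n : ℕ} (hn : 0 < n) :
    IsProbabilityMeasure (empLaw x n) :=
  isProbabilityMeasure_meanLaw (V' := fun ν => Measure.dirac (x ν)) hn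

/-! ### Variances of empirical means -/

variable {Ω : Type*} [MeasurableSpace Ω] {P : Measure Ω} {X : ℕ → Ω → ℝ × ℝ}

lemma integral_comp_hasLaw {μ : Measure (ℝ × ℝ)} {Y : Ω → ℝ × ℝ} (hY : HasLaw Y μ P)
    {f : ℝ × ℝ → ℝ} (hf : Measurable f) : ∫ ω, f (Y ω) ∂P = ∫ p, f p ∂μ :=
  hY.integral_comp hf.aestronglyMeasurable

lemma integrable_comp_hasLaw {μ : Measure (ℝ × ℝ)} {Y : Ω → ℝ × ℝ} (hY : HasLaw Y μ P)
    {f : ℝ × ℝ → ℝ} (hf : Measurable f) (h : Integrable f μ) : Integrable (fun ω => f (Y ω)) P := by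
  rw [← hY.map_eq] at h
  exact (integrable_map_measure hf.aestronglyMeasurable hY.aemeasurable).1 h

lemma aemeasurable_integral_empLaw (hX : ∀ ν, AEMeasurable (X ν) P) {f : ℝ × ℝ → ℝ}
    (hf : Measurable f) (n : ℕ) :
    AEMeasurable (fun ω => ∫ p, f p ∂(empLaw (fun ν => X ν ω) n)) P := by
  simp_rw [integral_empLaw]
  exact (Finset.aemeasurable_fun_sum _ fun k _ => hf.comp_aemeasurable (hX k)).const_mul _

/-- Measurability is read off from the explicit formula in five empirical raw moments, each a finite
average. -/
lemma aemeasurable_corr_empLaw (hX : ∀ ν, AEMeasurable (X ν) P) (n : ℕ) :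
    AEMeasurable (fun ω => corr (empLaw (fun ν => X ν ω) n)) P := by
  rcases Nat.eq_zero_or_pos n with rfl | hn
  · simp [empLaw]
  have h20 : ∀ ω, centralMoment 2 0 (empLaw (fun ν => X ν ω) n) =
      ∫ p, p.1 ^ 2 ∂(empLaw (fun ν => X ν ω) n) - (∫ p, p.1 ∂(empLaw (fun ν => X ν ω) n)) ^ 2 := by
    intro ω
    have := isProbabilityMeasure_empLaw (fun ν => X ν ω) hn
    exact centralMoment_two_zero (integrable_empLaw _ _ _) (integrable_empLaw _ _ _)
  have h02 : ∀ ω, centralMoment 0 2 (empLaw (fun ν => X ν ω) n) =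
      ∫ p, p.2 ^ 2 ∂(empLaw (fun ν => X ν ω) n) - (∫ p, p.2 ∂(empLaw (fun ν => X ν ω) n)) ^ 2 := by
    intro ω
    have := isProbabilityMeasure_empLaw (fun ν => X ν ω) hn
    exact centralMoment_zero_two (integrable_empLaw _ _ _) (integrable_empLaw _ _ _)
  have h11 : ∀ ω, centralMoment 1 1 (empLaw (fun ν => X ν ω) n) =
      ∫ p, p.1 * p.2 ∂(empLaw (fun ν => X ν ω) n) -
        (∫ p, p.1 ∂(empLaw (fun ν => X ν ω) n)) * ∫ p, p.2 ∂(empLaw (fun ν => X ν ω) n) := by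
    intro ω
    have := isProbabilityMeasure_empLaw (fun ν => X ν ω) hn
    exact centralMoment_one_one (integrable_empLaw _ _ _) (integrable_empLaw _ _ _)
  simp_rw [corr, h20, h02, h11]
  have m1 := aemeasurable_integral_empLaw hX (f := fun p => p.1) (by fun_prop) n
  have m2 := aemeasurable_integral_empLaw hX (f := fun p => p.2) (by fun_prop) n
  have m3 := aemeasurable_integral_empLaw hX (f := fun p => p.1 ^ 2) (by fun_prop) n
  have m4 := aemeasurable_integral_empLaw hX (f := fun p => p.2 ^ 2) (by fun_prop) n
  have m5 := aemeasurable_integral_empLaw hX (f := fun p => p.1 * p.2) (by fun_prop) n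
  exact (m5.sub (m1.mul m2)).div ((m3.sub (m1.pow_const 2)).mul (m4.sub (m2.pow_const 2))).sqrt

variable [IsProbabilityMeasure P] [∀ ν, IsProbabilityMeasure (V' ν)]

/-- The mean law integral is the expectation of the empirical one, so this is the variance of an
average of independent terms. -/
lemma integral_sq_empLaw_sub_meanLaw_le (hlaw : ∀ ν, HasLaw (X ν) (V' ν) P) (hindep : iIndepFun X P)
    {f : ℝ × ℝ → ℝ} (hf : Measurable f) (h2 : ∀ ν, Integrable (fun p => f p ^ 2) (V' ν)) {B : ℝ}
    (hB : ∀ ν, ∫ p, f p ^ 2 ∂(V' ν) ≤ B) (n : ℕ) :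
    Integrable (fun ω => (∫ p, f p ∂(empLaw (fun ν => X ν ω) n) - ∫ p, f p ∂(meanLaw V' n)) ^ 2) P ∧
    ∫ ω, (∫ p, f p ∂(empLaw (fun ν => X ν ω) n) - ∫ p, f p ∂(meanLaw V' n)) ^ 2 ∂P ≤ B / n := by
  have h1 : ∀ ν, Integrable f (V' ν) := fun ν =>
    integrable_of_integrable_sq hf.aestronglyMeasurable (h2 ν)
  have hm : ∀ ν, AEMeasurable (fun ω => f (X ν ω)) P := fun ν =>
    hf.comp_aemeasurable (hlaw ν).aemeasurable
  have hL : ∀ ν, MemLp (fun ω => f (X ν ω)) 2 P := fun ν =>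
    (memLp_two_iff_integrable_sq (hm ν).aestronglyMeasurable).2
      (integrable_comp_hasLaw (hlaw ν) (hf.pow_const 2) (h2 ν))
  have hi : ∀ ν, Integrable (fun ω => f (X ν ω)) P := fun ν => integrable_comp_hasLaw (hlaw ν) hf (h1 ν)
  set U : Ω → ℝ := ∑ k ∈ Finset.range n, fun ω => f (X k ω) with hU
  have hUL : MemLp U 2 P := memLp_finsetSum' _ fun k _ => hL k
  have hEU : ∫ ω, U ω ∂P = ∑ k ∈ Finset.range n, ∫ p, f p ∂(V' k) := by
    simp only [hU, Finset.sum_apply]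
    rw [integral_finsetSum _ fun k _ => hi k]
    exact Finset.sum_congr rfl fun k _ => integral_comp_hasLaw (hlaw k) hf
  have e : (fun ω => (∫ p, f p ∂(empLaw (fun ν => X ν ω) n) - ∫ p, f p ∂(meanLaw V' n)) ^ 2)
      = fun ω => ((n : ℝ)⁻¹) ^ 2 * (U ω - ∫ ω, U ω ∂P) ^ 2 := by
    ext ω
    rw [integral_empLaw, integral_meanLaw h1, hEU]
    simp only [hU, Finset.sum_apply]
    ring
  rw [e]
  have hsq : Integrable (fun ω => (U ω - ∫ ω, U ω ∂P) ^ 2) P :=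
    (hUL.sub (memLp_const _)).integrable_sq
  refine ⟨hsq.const_mul _, ?_⟩
  rw [integral_const_mul, ← variance_eq_integral hUL.aestronglyMeasurable.aemeasurable,
    hU, IndepFun.variance_sum (fun k _ => hL k)
      (fun i _ j _ hij => (hindep.indepFun hij).comp hf hf)]
  have hv : ∑ k ∈ Finset.range n, Var[fun ω => f (X k ω); P] ≤ n * B := by
    have : ∀ k ∈ Finset.range n, Var[fun ω => f (X k ω); P] ≤ B := fun k _ => by
      refine (variance_le_expectation_sq (hm k).aestronglyMeasurable).trans ?_
      have := integral_comp_hasLaw (hlaw k) (hf.pow_const 2)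
      simp only [Pi.pow_apply]
      rw [this]
      exact hB k
    simpa using Finset.sum_le_sum this
  refine (mul_le_mul_of_nonneg_left hv (by positivity)).trans (le_of_eq ?_)
  rcases Nat.eq_zero_or_pos n with rfl | hn
  · simp
  · field_simp

/-- The first and second empirical moments are within `O(n ^ (-1/2))` of their means, in `L²`. -/
lemma integral_momentDistSq_le (hlaw : ∀ ν, HasLaw (X ν) (V' ν) P) (hindep : iIndepFun X P) {B : ℝ}
    (hW : ∀ ν, Integrable sixthWeight (V' ν) ∧ ∫ p, sixthWeight p ∂(V' ν) ≤ B) (n : ℕ) :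
    Integrable (fun ω => momentDistSq (meanLaw V' n) (empLaw (fun ν => X ν ω) n)) P ∧
    ∫ ω, momentDistSq (meanLaw V' n) (empLaw (fun ν => X ν ω) n) ∂P ≤ 5 * B / n := by
  have key : ∀ f : ℝ × ℝ → ℝ, Measurable f → (∀ p, f p ^ 2 ≤ sixthWeight p) →
      Integrable (fun ω => (∫ p, f p ∂(empLaw (fun ν => X ν ω) n) - ∫ p, f p ∂(meanLaw V' n)) ^ 2) P ∧
      ∫ ω, (∫ p, f p ∂(empLaw (fun ν => X ν ω) n) - ∫ p, f p ∂(meanLaw V' n)) ^ 2 ∂P ≤ B / n := by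
    intro f hf hle
    have hh := fun ν => integrable_of_le_sixthWeight (hW ν).1 (hf.pow_const 2)
      (fun p => sq_nonneg (f p)) hle
    exact integral_sq_empLaw_sub_meanLaw_le hlaw hindep hf (fun ν => (hh ν).1)
      (fun ν => (hh ν).2.trans (hW ν).2) n
  obtain ⟨i1, b1⟩ := key (fun p => p.1) (by fun_prop) fun p => (sq_le_sixthWeight p).1
  obtain ⟨i2, b2⟩ := key (fun p => p.2) (by fun_prop) fun p => (sq_le_sixthWeight p).2.1
  obtain ⟨i3, b3⟩ := key (fun p => p.1 ^ 2) (by fun_prop) fun p => (sq_le_sixthWeight p).2.2.1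
  obtain ⟨i4, b4⟩ := key (fun p => p.2 ^ 2) (by fun_prop) fun p => (sq_le_sixthWeight p).2.2.2.1
  obtain ⟨i5, b5⟩ := key (fun p => p.1 * p.2) (by fun_prop) fun p => (sq_le_sixthWeight p).2.2.2.2
  unfold momentDistSq
  refine ⟨(((i1.add i2).add i3).add i4).add i5, ?_⟩
  rw [integral_add (by exact ((i1.add i2).add i3).add i4) i5,
    integral_add (by exact (i1.add i2).add i3) i4, integral_add (by exact i1.add i2) i3,
    integral_add i1 i2]
  have : 5 * B / n = B / n + B / n + B / n + B / n + B / n := by ring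
  linarith

/-! ### Growth of the derivative -/

lemma abs_quadratic_le {L c₁ c₂ c₃ c₄ c₅ k : ℝ} (h1 : |c₁| ≤ L) (h2 : |c₂| ≤ L) (h3 : |c₃| ≤ L)
    (h4 : |c₄| ≤ L) (h5 : |c₅| ≤ L) (hk : |k| ≤ L) (p : ℝ × ℝ) :
    |c₁ * (p.1 * p.2) + c₂ * p.1 + c₃ * p.2 + c₄ * p.1 ^ 2 + c₅ * p.2 ^ 2 + k|
      ≤ 3 * L * (1 + p.1 ^ 2 + p.2 ^ 2) := by
  have hL : 0 ≤ L := (abs_nonneg _).trans h1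
  have key : ∀ {c x m : ℝ}, |c| ≤ L → |x| ≤ m → |c * x| ≤ L * m := fun hc hx => by
    rw [abs_mul]; exact mul_le_mul hc hx (abs_nonneg _) hL
  have b1 := key h1 (show |p.1 * p.2| ≤ (p.1 ^ 2 + p.2 ^ 2) / 2 by
    rw [abs_le]; constructor <;> linarith [sq_nonneg (p.1 + p.2), sq_nonneg (p.1 - p.2)])
  have hx : ∀ x : ℝ, |x| ≤ (1 + x ^ 2) / 2 := fun x => by
    rw [abs_le]; constructor <;> linarith [sq_nonneg (x + 1), sq_nonneg (x - 1)]
  have b2 := key h2 (hx p.1)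
  have b3 := key h3 (hx p.2)
  have b4 := key h4 (abs_of_nonneg (sq_nonneg p.1)).le
  have b5 := key h5 (abs_of_nonneg (sq_nonneg p.2)).le
  have e : L * ((p.1 ^ 2 + p.2 ^ 2) / 2) + L * ((1 + p.1 ^ 2) / 2) + L * ((1 + p.2 ^ 2) / 2)
      + L * p.1 ^ 2 + L * p.2 ^ 2 + L + L * (1 + p.1 ^ 2 + p.2 ^ 2)
      = 3 * L * (1 + p.1 ^ 2 + p.2 ^ 2) := by ring
  have h0 : 0 ≤ L * (1 + p.1 ^ 2 + p.2 ^ 2) := by positivity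
  rw [abs_le] at *
  constructor <;> linarith

lemma measurable_corrDeriv (μ : Measure (ℝ × ℝ)) : Measurable (corrDeriv μ) := by
  rw [corrDeriv_eq_quadratic]
  fun_prop

/-- Here `L` may depend on the law, even a degenerate one; this gives integrability for every `n`.
-/
lemma exists_abs_corrDeriv_le (μ : Measure (ℝ × ℝ)) :
    ∃ L, 0 ≤ L ∧ ∀ p, |corrDeriv μ p| ≤ L * (1 + p.1 ^ 2 + p.2 ^ 2) := by
  rw [corrDeriv_eq_quadratic]
  set c₁ := 1 / √(centralMoment 2 0 μ * centralMoment 0 2 μ)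
  set c₂ := corr μ * meanFst μ / centralMoment 2 0 μ
          - meanSnd μ / √(centralMoment 2 0 μ * centralMoment 0 2 μ)
  set c₃ := corr μ * meanSnd μ / centralMoment 0 2 μ
          - meanFst μ / √(centralMoment 2 0 μ * centralMoment 0 2 μ)
  set c₄ := -corr μ / (2 * centralMoment 2 0 μ)
  set c₅ := -corr μ / (2 * centralMoment 0 2 μ)
  have n1 := abs_nonneg c₁
  have n2 := abs_nonneg c₂
  have n3 := abs_nonneg c₃
  have n4 := abs_nonneg c₄
  have n5 := abs_nonneg c₅
  refine ⟨3 * (|c₁| + |c₂| + |c₃| + |c₄| + |c₅|), by positivity, fun p => ?_⟩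
  exact abs_quadratic_le (by linarith) (by linarith) (by linarith) (by linarith) (by linarith)
    (by rw [abs_zero]; linarith) p

/-- The uniform `L` is what bounds the Lyapunov sum. -/
lemma exists_abs_corrDeriv_le_of_bounds {c B : ℝ} (hc : 0 < c) (hB : 0 ≤ B) :
    ∃ L, 0 ≤ L ∧ ∀ μ : Measure (ℝ × ℝ), |meanFst μ| ≤ B → |meanSnd μ| ≤ B →
      c ≤ centralMoment 2 0 μ → c ≤ centralMoment 0 2 μ → |centralMoment 1 1 μ| ≤ B →
      ∀ p, |corrDeriv μ p| ≤ L * (1 + p.1 ^ 2 + p.2 ^ 2) := by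
  refine ⟨3 * (1 / c + B / c * B / c + B / c + B / c / c), by positivity, ?_⟩
  intro μ ha hb hp hq hM p
  have hσ : c ≤ √(centralMoment 2 0 μ * centralMoment 0 2 μ) := by
    refine Real.le_sqrt_of_sq_le ?_
    rw [sq]
    exact mul_le_mul hp hq hc.le (hc.le.trans hp)
  have hG : |corr μ| ≤ B / c := abs_div_le_div hc hσ hM
  have i1 : 0 ≤ 1 / c := by positivity
  have i2 : 0 ≤ B / c * B / c := by positivity
  have i3 : 0 ≤ B / c := by positivity
  have i4 : 0 ≤ B / c / c := by positivity
  have hm : ∀ {x}, |x| ≤ B → |corr μ * x| ≤ B / c * B := fun hx => by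
    rw [abs_mul]; exact mul_le_mul hG hx (abs_nonneg _) i3
  have h2p : c ≤ 2 * centralMoment 2 0 μ := by linarith
  have h2q : c ≤ 2 * centralMoment 0 2 μ := by linarith
  rw [corrDeriv_eq_quadratic]
  refine abs_quadratic_le ?_ ?_ ?_ ?_ ?_ ?_ p
  · have := abs_div_le_div (x := 1) hc hσ abs_one.le
    linarith
  · have h1 := abs_div_le_div hc hp (hm ha)
    have h2 := abs_div_le_div hc hσ hb
    have := abs_sub (corr μ * meanFst μ / centralMoment 2 0 μ)
      (meanSnd μ / √(centralMoment 2 0 μ * centralMoment 0 2 μ))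
    linarith
  · have h1 := abs_div_le_div hc hq (hm hb)
    have h2 := abs_div_le_div hc hσ ha
    have := abs_sub (corr μ * meanSnd μ / centralMoment 0 2 μ)
      (meanFst μ / √(centralMoment 2 0 μ * centralMoment 0 2 μ))
    linarith
  · have := abs_div_le_div hc h2p (x := -corr μ) (Q := B / c) (by rwa [abs_neg])
    linarith
  · have := abs_div_le_div hc h2q (x := -corr μ) (Q := B / c) (by rwa [abs_neg])
    linarith
  · rw [abs_zero]; positivity

end StatFun

namespace StatFun

/-! ### Growth of the standard deviations -/

/-- Since `δ < 1`, the exponent `1/(2 + δ)` is at least `1/3`, the rate that third moments require.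
-/
lemma tendsto_sdSum_div_rpow_third {V' : ℕ → Measure (ℝ × ℝ)} {δ : ℝ} (hδ₀ : 0 < δ) (hδ₁ : δ < 1)
    (hs : Tendsto (fun n : ℕ => sdSum V' n / (n : ℝ) ^ (1 / (2 + δ))) atTop atTop) :
    Tendsto (fun n : ℕ => sdSum V' n / (n : ℝ) ^ (1 / 3 : ℝ)) atTop atTop := by
  refine tendsto_atTop_mono' _ ?_ hs
  filter_upwards [eventually_ge_atTop 1] with n hn
  have hn1 : (1 : ℝ) ≤ n := by exact_mod_cast hn
  refine div_le_div_of_nonneg_left (Real.sqrt_nonneg _) (by positivity) ?_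
  refine Real.rpow_le_rpow_of_exponent_le hn1 ?_
  exact one_div_le_one_div_of_le (by linarith) (by linarith)

lemma tendsto_sdSum {V' : ℕ → Measure (ℝ × ℝ)}
    (hs : Tendsto (fun n : ℕ => sdSum V' n / (n : ℝ) ^ (1 / 3 : ℝ)) atTop atTop) :
    Tendsto (fun n : ℕ => sdSum V' n) atTop atTop := by
  refine tendsto_atTop_mono' _ ?_ hs
  filter_upwards [eventually_ge_atTop 1] with n hn
  have hn1 : (1 : ℝ) ≤ n := by exact_mod_cast hn
  exact div_le_self (Real.sqrt_nonneg _) (Real.one_le_rpow hn1 (by norm_num))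

lemma tendsto_nat_div_sdSum_pow_three {V' : ℕ → Measure (ℝ × ℝ)}
    (hs : Tendsto (fun n : ℕ => sdSum V' n / (n : ℝ) ^ (1 / 3 : ℝ)) atTop atTop) :
    Tendsto (fun n : ℕ => n / sdSum V' n ^ 3) atTop (𝓝 0) := by
  have h := ((tendsto_pow_atTop (α := ℝ) (n := 3) (by norm_num)).comp hs).inv_tendsto_atTop
  refine h.congr fun n => ?_
  simp only [Function.comp_apply, Pi.inv_apply, div_pow]
  have e : ((n : ℝ) ^ (1 / 3 : ℝ)) ^ 3 = n := by
    rw [← Real.rpow_natCast, ← Real.rpow_mul (Nat.cast_nonneg n)]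
    norm_num
  rw [e, inv_div]

/-! ### Asymptotic normality -/

section

variable {Ω : Type*} {V' : ℕ → Measure (ℝ × ℝ)} {X : ℕ → Ω → ℝ × ℝ}

/-- The `k`-th term of the normalized linear part of the empirical correlation coefficient. -/
def linearTerm (V' : ℕ → Measure (ℝ × ℝ)) (X : ℕ → Ω → ℝ × ℝ) (n k : ℕ) (ω : Ω) : ℝ :=
  (corrDeriv (meanLaw V' n) (X k ω) - ∫ z, corrDeriv (meanLaw V' n) z ∂(V' k)) /
    (√2 * sdSum V' n)

/-- The factor `n` in `normConst` cancels the `1/n` of both averages. -/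
lemma sum_linearTerm {n : ℕ} (hn : 0 < n) (hi : ∀ ν, Integrable (corrDeriv (meanLaw V' n)) (V' ν))
    (ω : Ω) :
    ∑ k ∈ Finset.range n, linearTerm V' X n k ω = normConst V' n *
      (∫ p, corrDeriv (meanLaw V' n) p ∂(empLaw (fun ν => X ν ω) n) -
        ∫ p, corrDeriv (meanLaw V' n) p ∂(meanLaw V' n)) := by
  have hn' : (n : ℝ) ≠ 0 := by exact_mod_cast hn.ne'
  unfold linearTerm
  rw [integral_empLaw, integral_meanLaw hi, ← mul_sub, ← Finset.sum_sub_distrib, ← Finset.sum_div,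
    normConst, ← mul_assoc, div_mul_eq_mul_div, mul_inv_cancel₀ hn', one_div_mul_eq_div]

variable [MeasurableSpace Ω] {P : Measure Ω} [IsProbabilityMeasure P]
  [∀ ν, IsProbabilityMeasure (V' ν)]

/-- Raw moments are at most `3B`; the extra `(3B)²` pays for the product of means in the covariance.
-/
lemma meanLaw_bounds {B : ℝ}
    (hW : ∀ ν, Integrable sixthWeight (V' ν) ∧ ∫ p, sixthWeight p ∂(V' ν) ≤ B) {n : ℕ}
    (hn : 0 < n) :
    Integrable (fun p : ℝ × ℝ => p.1 ^ 2) (meanLaw V' n) ∧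
    Integrable (fun p : ℝ × ℝ => p.2 ^ 2) (meanLaw V' n) ∧
    |meanFst (meanLaw V' n)| ≤ 3 * B + (3 * B) ^ 2 ∧
    |meanSnd (meanLaw V' n)| ≤ 3 * B + (3 * B) ^ 2 ∧
    |centralMoment 1 1 (meanLaw V' n)| ≤ 3 * B + (3 * B) ^ 2 := by
  have := isProbabilityMeasure_meanLaw (V' := V') hn
  have hWi : Integrable sixthWeight (meanLaw V' n) := integrable_meanLaw (fun ν => (hW ν).1) n
  have hWB : ∫ p, sixthWeight p ∂(meanLaw V' n) ≤ B :=
    integral_meanLaw_le (fun ν => (hW ν).1) (fun ν => (hW ν).2) hn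
  have hx := (integrable_of_le_sixthWeight hWi (f := fun p => p.1 ^ 2) (by fun_prop)
    (fun p => sq_nonneg _) fun p => (sq_le_sixthWeight p).1).1
  have hy := (integrable_of_le_sixthWeight hWi (f := fun p => p.2 ^ 2) (by fun_prop)
    (fun p => sq_nonneg _) fun p => (sq_le_sixthWeight p).2.1).1
  have key : ∀ f : ℝ × ℝ → ℝ, (∀ p, |f p| ≤ 1 + p.1 ^ 2 + p.2 ^ 2) →
      |∫ p, f p ∂(meanLaw V' n)| ≤ 3 * B := by
    intro f hf
    have h1 : ‖∫ p, f p ∂(meanLaw V' n)‖ ≤ ∫ p, 3 * sixthWeight p ∂(meanLaw V' n) :=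
      norm_integral_le_of_norm_le (hWi.const_mul 3)
        (ae_of_all _ fun p => (hf p).trans (one_add_sq_add_sq_le_sixthWeight p))
    rw [integral_const_mul] at h1
    exact h1.trans (mul_le_mul_of_nonneg_left hWB (by norm_num))
  have ha : |meanFst (meanLaw V' n)| ≤ 3 * B := key _ fun p => by
    rw [abs_le]
    constructor <;> nlinarith [sq_nonneg (p.1 + 1), sq_nonneg (p.1 - 1), sq_nonneg p.2, sq_nonneg p.1]
  have hb : |meanSnd (meanLaw V' n)| ≤ 3 * B := key _ fun p => by
    rw [abs_le]
    constructor <;> nlinarith [sq_nonneg (p.2 + 1), sq_nonneg (p.2 - 1), sq_nonneg p.2, sq_nonneg p.1]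
  have hxy : |∫ p, p.1 * p.2 ∂(meanLaw V' n)| ≤ 3 * B := key _ fun p => by
    rw [abs_le]
    constructor <;> nlinarith [sq_nonneg (p.1 + p.2), sq_nonneg (p.1 - p.2), sq_nonneg p.2, sq_nonneg p.1]
  have hB : 0 ≤ 3 * B := (abs_nonneg _).trans ha
  have hB2 : 0 ≤ (3 * B) ^ 2 := sq_nonneg _
  refine ⟨hx, hy, by linarith, by linarith, ?_⟩
  rw [centralMoment_one_one hx hy]
  refine (abs_sub _ _).trans (add_le_add hxy ?_)
  rw [abs_mul, sq]
  exact mul_le_mul ha hb (abs_nonneg _) hB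

/-- The linear part of the empirical correlation coefficient is asymptotically normal. -/
theorem tendstoInDistribution_sum_linearTerm (hlaw : ∀ ν, HasLaw (X ν) (V' ν) P)
    (hindep : iIndepFun X P) {B c : ℝ} (hc : 0 < c)
    (hW : ∀ ν, Integrable sixthWeight (V' ν) ∧ ∫ p, sixthWeight p ∂(V' ν) ≤ B)
    (hvar : ∀ᶠ n : ℕ in atTop, c ≤ centralMoment 2 0 (meanLaw V' n) ∧
      c ≤ centralMoment 0 2 (meanLaw V' n))
    (hs : Tendsto (fun n : ℕ => sdSum V' n / (n : ℝ) ^ (1 / 3 : ℝ)) atTop atTop) :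
    TendstoInDistribution (fun n ω => ∑ k ∈ Finset.range n, linearTerm V' X n k ω) atTop
      (id : ℝ → ℝ) (fun _ => P) (gaussianReal 0 (1 / 2)) := by
  have hB : 0 ≤ B := (integral_nonneg sixthWeight_nonneg).trans (hW 0).2
  have hmeas : ∀ n k, Measurable fun p : ℝ × ℝ => (corrDeriv (meanLaw V' n) p
      - ∫ z, corrDeriv (meanLaw V' n) z ∂(V' k)) / (√2 * sdSum V' n) :=
    fun n k => ((measurable_corrDeriv _).sub_const _).div_const _
  have hint : ∀ n k, Integrable (corrDeriv (meanLaw V' n)) (V' k) ∧ Integrable (fun p =>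
      |corrDeriv (meanLaw V' n) p - ∫ z, corrDeriv (meanLaw V' n) z ∂(V' k)| ^ 3) (V' k) := by
    intro n k
    obtain ⟨L, hL, h⟩ := exists_abs_corrDeriv_le (meanLaw V' n)
    have := integral_abs_sub_integral_pow_three_le hL (hW k).1 (hW k).2 (measurable_corrDeriv _) h
    exact ⟨this.1, this.2.1⟩
  have habs3 : ∀ n k p, |(corrDeriv (meanLaw V' n) p - ∫ z, corrDeriv (meanLaw V' n) z ∂(V' k)) /
      (√2 * sdSum V' n)| ^ 3 = |corrDeriv (meanLaw V' n) p
        - ∫ z, corrDeriv (meanLaw V' n) z ∂(V' k)| ^ 3 / (√2 * sdSum V' n) ^ 3 := by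
    intro n k p
    have h0 : 0 ≤ √2 * sdSum V' n := mul_nonneg (Real.sqrt_nonneg 2) (Real.sqrt_nonneg _)
    rw [abs_div, div_pow, abs_of_nonneg h0]
  refine tendstoInDistribution_of_lyapunov ?_ ?_ ?_ ?_ ?_ ?_
  · exact fun n => hindep.comp _ (hmeas n)
  · exact fun n k => (hmeas n k).comp_aemeasurable (hlaw k).aemeasurable
  · intro n k
    refine integrable_comp_hasLaw (hlaw k) ((hmeas n k).abs.pow_const 3) ?_
    simp_rw [habs3]
    exact (hint n k).2.div_const _
  · intro n k
    refine (integral_comp_hasLaw (hlaw k) (hmeas n k)).trans ?_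
    rw [integral_div, integral_sub (hint n k).1 (integrable_const _)]
    simp
  -- Once `s_n > 0`, dividing by `√2 s_n` makes the row variance exactly `1/2`.
  · filter_upwards [(tendsto_sdSum hs).eventually_gt_atTop 0] with n hn
    have e : ∀ k, ∫ ω, linearTerm V' X n k ω ^ 2 ∂P = (∫ p, (corrDeriv (meanLaw V' n) p
        - ∫ z, corrDeriv (meanLaw V' n) z ∂(V' k)) ^ 2 ∂(V' k)) / (2 * sdSum V' n ^ 2) := by
      intro k
      refine (integral_comp_hasLaw (hlaw k) ((hmeas n k).pow_const 2)).trans ?_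
      simp_rw [div_pow]
      rw [integral_div, mul_pow, Real.sq_sqrt zero_le_two]
    simp_rw [e]
    rw [← Finset.sum_div]
    have e2 : ∑ k ∈ Finset.range n, ∫ p, (corrDeriv (meanLaw V' n) p
        - ∫ z, corrDeriv (meanLaw V' n) z ∂(V' k)) ^ 2 ∂(V' k) = sdSum V' n ^ 2 := by
      rw [sdSum, Real.sq_sqrt]
      exact Finset.sum_nonneg fun k _ => integral_nonneg fun p => sq_nonneg _
    rw [e2]
    push_cast
    field_simp
  · obtain ⟨L, hL, hLb⟩ := exists_abs_corrDeriv_le_of_bounds hc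
      (B := 3 * B + (3 * B) ^ 2) (by positivity)
    set T := 9 * (L + 3 * L * B) ^ 3 * B with hT
    have hlim := (tendsto_nat_div_sdSum_pow_three hs).const_mul T
    rw [mul_zero] at hlim
    refine squeeze_zero' (Eventually.of_forall fun n => Finset.sum_nonneg fun k _ =>
      integral_nonneg fun ω => by positivity) ?_ hlim
    filter_upwards [hvar, eventually_gt_atTop 0, (tendsto_sdSum hs).eventually_gt_atTop 0]
      with n hv hn hsn
    obtain ⟨-, -, ha, hb, hM⟩ := meanLaw_bounds hW hn
    have hbound : ∀ k ∈ Finset.range n,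
        ∫ ω, |linearTerm V' X n k ω| ^ 3 ∂P ≤ T / sdSum V' n ^ 3 := by
      intro k _
      refine (le_of_eq (integral_comp_hasLaw (hlaw k) ((hmeas n k).abs.pow_const 3))).trans ?_
      simp_rw [habs3]
      rw [integral_div]
      have h3 := (integral_abs_sub_integral_pow_three_le hL (hW k).1 (hW k).2
        (measurable_corrDeriv _) (hLb _ ha hb hv.1 hv.2 hM)).2.2
      refine div_le_div₀ (by positivity) h3 (by positivity) ?_
      refine pow_le_pow_left₀ hsn.le (le_mul_of_one_le_left hsn.le ?_) 3
      exact Real.one_le_sqrt.2 one_le_two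
    have hsum := Finset.sum_le_sum hbound
    simp only [Finset.sum_const, Finset.card_range, nsmul_eq_mul] at hsum
    refine hsum.trans (le_of_eq ?_)
    ring

/-- The normalized linearization error tends to zero in probability. -/
lemma tendstoInMeasure_normConst_mul_sub (hlaw : ∀ ν, HasLaw (X ν) (V' ν) P)
    (hindep : iIndepFun X P) {B c : ℝ} (hc : 0 < c)
    (hW : ∀ ν, Integrable sixthWeight (V' ν) ∧ ∫ p, sixthWeight p ∂(V' ν) ≤ B)
    (hvar : ∀ᶠ n : ℕ in atTop, c ≤ centralMoment 2 0 (meanLaw V' n) ∧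
      c ≤ centralMoment 0 2 (meanLaw V' n))
    (hs : Tendsto (fun n : ℕ => sdSum V' n) atTop atTop) :
    TendstoInMeasure P ((fun (n : ℕ) ω => normConst V' n *
        (corr (empLaw (fun ν => X ν ω) n) - corr (meanLaw V' n))) -
      fun n ω => ∑ k ∈ Finset.range n, linearTerm V' X n k ω) atTop 0 := by
  have hB : 0 ≤ B := (integral_nonneg sixthWeight_nonneg).trans (hW 0).2
  obtain ⟨C, hC, η, hη, hexp⟩ := exists_corr_expansion hc
    (B := 3 * B + (3 * B) ^ 2) (by positivity)
  rw [tendstoInMeasure_iff_measureReal_norm]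
  intro e he
  -- The two terms are Markov bounds for `Q` at the thresholds `η` and `e s_n / (nC)`, using `E Q ≤
  -- 5B/n`.
  have hlim : Tendsto (fun n : ℕ => 5 * B / η * (n : ℝ)⁻¹ + 5 * B * C / e * (sdSum V' n)⁻¹) atTop
      (𝓝 0) := by
    simpa using (tendsto_inv_atTop_nhds_zero_nat.const_mul (5 * B / η)).add
      (hs.inv_tendsto_atTop.const_mul (5 * B * C / e))
  refine squeeze_zero' (Eventually.of_forall fun n => measureReal_nonneg) ?_ hlim
  filter_upwards [hvar, eventually_gt_atTop 0, hs.eventually_gt_atTop 0] with n hv hn hsn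
  have hn' : (0 : ℝ) < n := by exact_mod_cast hn
  obtain ⟨hx, hy, ha, hb, hM⟩ := meanLaw_bounds hW hn
  set Q : Ω → ℝ := fun ω => momentDistSq (meanLaw V' n) (empLaw (fun ν => X ν ω) n) with hQ
  obtain ⟨hQi, hQB⟩ := integral_momentDistSq_le hlaw hindep hW n
  have hQ0 : 0 ≤ᵐ[P] Q := ae_of_all _ fun ω => by
    simp only [hQ, momentDistSq, Pi.zero_apply]; positivity
  have hH : normConst V' n ≤ n / sdSum V' n := by
    unfold normConst
    refine div_le_div_of_nonneg_left hn'.le hsn (le_mul_of_one_le_left hsn.le ?_)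
    exact Real.one_le_sqrt.2 one_le_two
  have hH0 : 0 < normConst V' n := div_pos hn' (by positivity)
  -- Where `Q < η` the expansion applies, and an error of at least `e` forces `e ≤ (n / s_n) C Q`.
  have hsub : {ω | e ≤ ‖((fun (n : ℕ) ω => normConst V' n *
        (corr (empLaw (fun ν => X ν ω) n) - corr (meanLaw V' n))) -
      fun n ω => ∑ k ∈ Finset.range n, linearTerm V' X n k ω) n ω - (0 : ℕ → Ω → ℝ) n ω‖} ⊆
      {ω | η ≤ Q ω} ∪ {ω | e * sdSum V' n / (n * C) ≤ Q ω} := by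
    intro ω hω
    by_cases hq : η ≤ Q ω
    · exact Or.inl hq
    right
    have hV := isProbabilityMeasure_meanLaw (V' := V') hn
    have hS := isProbabilityMeasure_empLaw (fun ν => X ν ω) hn
    have hi : ∀ ν, Integrable (corrDeriv (meanLaw V' n)) (V' ν) := fun ν => by
      obtain ⟨L, hL, h⟩ := exists_abs_corrDeriv_le (meanLaw V' n)
      exact (integral_abs_sub_integral_pow_three_le hL (hW ν).1 (hW ν).2
        (measurable_corrDeriv _) h).1
    have hE := hexp (meanLaw V' n) (empLaw (fun ν => X ν ω) n) hV hS hx hy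
      (integrable_empLaw _ _ _) (integrable_empLaw _ _ _) ha hb hv.1 hv.2 hM (not_le.1 hq).le
    have hω' : e ≤ |normConst V' n * (corr (empLaw (fun ν => X ν ω) n) - corr (meanLaw V' n))
        - ∑ k ∈ Finset.range n, linearTerm V' X n k ω| := by
      simpa using hω
    rw [sum_linearTerm hn hi, ← mul_sub, abs_mul, abs_of_pos hH0] at hω'
    have h1 : e ≤ n / sdSum V' n * (C * Q ω) :=
      hω'.trans (mul_le_mul hH hE (abs_nonneg _) (by positivity))
    change e * sdSum V' n / (n * C) ≤ Q ω
    rw [div_le_iff₀ (by positivity)]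
    rw [div_mul_eq_mul_div, le_div_iff₀ hsn] at h1
    linarith
  have hmarkov : ∀ r > 0, P.real {ω | r ≤ Q ω} ≤ 5 * B / n / r := fun r hr => by
    rw [le_div_iff₀ hr, mul_comm]
    exact (mul_meas_ge_le_integral_of_nonneg hQ0 hQi r).trans hQB
  refine (measureReal_mono hsub).trans ((measureReal_union_le _ _).trans ?_)
  refine (add_le_add (hmarkov η hη) (hmarkov _ (by positivity))).trans (le_of_eq ?_)
  field_simp

end

end StatFun

end

theorem mainTheorem2
    {Ω : Type*} [MeasurableSpace Ω] (P : Measure Ω) [IsProbabilityMeasure P]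
    (V' : ℕ → Measure (ℝ × ℝ)) [∀ ν, IsProbabilityMeasure (V' ν)]
    (X : ℕ → Ω → ℝ × ℝ)
    (hlaw : ∀ ν, HasLaw (X ν) (V' ν) P)
    (hindep : iIndepFun X P)
    (ε N K : ℝ) (hε : 0 < ε) (hN : 0 < N)
    (htail : StatFun.UniformTail V' (6 + ε) N K)
    (c : ℝ) (hc : 0 < c)
    (hvar : ∀ᶠ n : ℕ in atTop,
      c ≤ StatFun.centralMoment 2 0 (StatFun.meanLaw V' n) ∧
      c ≤ StatFun.centralMoment 0 2 (StatFun.meanLaw V' n))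
    (δ : ℝ) (hδ₀ : 0 < δ) (hδ₁ : δ < 1)
    (hs : Tendsto (fun n : ℕ => StatFun.sdSum V' n / (n : ℝ) ^ (1 / (2 + δ))) atTop atTop) :
    (∀ᶠ n : ℕ in atTop,
      StatFun.HasStatDeriv StatFun.corrDomain StatFun.corr (StatFun.meanLaw V' n)
        (StatFun.corrDeriv (StatFun.meanLaw V' n))) ∧
    TendstoUniformly
      (fun (n : ℕ) (u : ℝ) =>
        P.real {ω | StatFun.normConst V' n *
          (StatFun.corr (StatFun.empLaw (fun ν => X ν ω) n) -
            StatFun.corr (StatFun.meanLaw V' n)) ≤ u})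
      StatFun.gaussLimit atTop := by
  obtain ⟨B, -, hW⟩ := StatFun.exists_integral_sixthWeight_le hε hN htail
  have hs3 := StatFun.tendsto_sdSum_div_rpow_third hδ₀ hδ₁ hs
  constructor
  · filter_upwards [hvar, eventually_gt_atTop 0] with n hv hn
    obtain ⟨hx, hy, -⟩ := StatFun.meanLaw_bounds hW hn
    exact StatFun.hasStatDeriv_corr ⟨StatFun.isProbabilityMeasure_meanLaw hn, hx, hy,
      hc.trans_le hv.1, hc.trans_le hv.2⟩
  · refine StatFun.tendstoUniformly_gaussLimit_of_tendstoInDistribution ?_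
    -- Slutsky: the statistic differs from its linear part by a term vanishing in probability.
    refine tendstoInDistribution_of_tendstoInMeasure_sub _ _
      (StatFun.tendstoInDistribution_sum_linearTerm hlaw hindep hc hW hvar hs3)
      (StatFun.tendstoInMeasure_normConst_mul_sub hlaw hindep hc hW hvar
        (StatFun.tendsto_sdSum hs3)) fun n => ?_
    exact ((StatFun.aemeasurable_corr_empLaw (fun ν => (hlaw ν).aemeasurable) n).sub_const
      _).const_mul _
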